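/- Let $\rho=1.75$, $\varrho_0=5.79833984375\times10^{-4}$, $\delta=0.00124359130859375$. Let $\mathcal A_s(\rho)$ be the complex Banach space of power series $s(x,y)=\sum_{i,j\ge0}c_{ij}x^iy^j$ with $\|s\|_\rho=\sum|c_{ij}|\rho^{i+j}<\infty$ and $\partial_1s(x,y)=\partial_1s(y,x)$, and write $\mathcal D_r=\{(x,y)\in\mathbb C^2:|x|,|y|<r\}$. Subscripts $1,2$ denote partial derivatives and $f_{(i,j)}$ denotes a Taylor coefficient at the origin. Let $s_0\in\mathcal A_s(\rho)$ be a polynomial, let $s^*\in\mathcal B_{\varrho_0}(s_0)\subset\mathcal A_s(\rho)$, and let $U\subset\mathcal A_s(\rho)$ be an open neighbourhood of $s^*$ on which the following operators are defined. (a) For some $0<r\le\rho$ there is a continuous function $(s,x,y)\mapsto Z[s](x,y)$ on $U\times\mathcal D_r$ with $|Z|<\rho$ such that $z=Z[s](x,y)$ is a simple root of $s(x,z)+s(y,z)=0$. Put $G[s](x,y)=(Z[s](x,y),y)$. (b) For a function $t:U\to\mathbb C$ put $\mathcal P_t[s](x,y)=(1+2t[s]y)\,(s\circ G[s])(x+t[s]x^2,\,y+t[s]y^2)$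 and $\mathcal R_t[s](x,y)=\mu[s]^{-1}\mathcal P_t[s](\lambda[s]x,\lambda[s]y)$, where $\lambda:U\to\mathbb C$ is continuous, $\mathcal P_t[s](\lambda[s],0)=0$, $\mu[s]=\lambda[s]\,\partial_1\mathcal P_t[s](\lambda[s],0)\neq0$, and $|\lambda[s]x+t[s](\lambda[s]x)^2|<r$ for $|x|\le\rho$. (c) $\mathcal R_{EKW}$ is the operator with $t\equiv0$. Suppose $\mathcal R_{EKW}[s^*]=s^*$, and let $\lambda_*=\lambda[s^*]$ be the corresponding scaling. Put $$\psi(x,y)=s^*_1x^2+s^*_2y^2+2s^*y-s^*-(s^*_1x+s^*_2y).$$ (d) $\mathcal R$ is the operator with $$t[s]=-\lambda_*^{-1}\,\ell\big(E(\lambda_*)(\mathcal R_{EKW}[s]-s^*)\big),\qquad E(\lambda_*)=\frac1{2\pi i}\oint_{|z-\lambda_*|=\varepsilon}(z-D\mathcal R_{EKW}[s^*])^{-1}dz,$$ where $\varepsilon>0$ is such that the closed disk $|z-\lambda_*|\le\varepsilon$ contains no point of ${\rm spec}(D\mathcal R_{EKW}[s^*])$ except possibly $\lambda_*$, and $\ell$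 is any bounded linear functional on $\mathcal A_s(\rho)$ with $\ell(\psi)=1$ (if $E(\lambda_*)$ has rank one, $\ell(E(\lambda_*)v)$ is the coefficient $a$ in $E(\lambda_*)v=a\psi$). (e) $\mathcal R_{c^*}$ is the operator with $$t[s]=\frac14\,\frac{c^*-(s\circ G[s])_{(0,3)}}{(s\circ G[s])_{(0,2)}},\qquad c^*=(s^*\circ G[s^*])_{(0,3)},$$ where $(s\circ G[s])_{(0,2)}\ne0$ on $U$. Suppose that $s^*$ is a fixed point of $\mathcal R$ and of $\mathcal R_{c^*}$, the scalings $\lambda[s^*]$ of these two operators being $\lambda_*$ as well. Then $\mathcal R_{EKW}$, $\mathcal R$ and $\mathcal R_{c^*}$ are (complex) differentiable at $s^*$, and $${\rm spec}\left(D\mathcal R[s^*]\right)\setminus\{z\in\mathbb C:|z|\le\delta\}\subset{\rm spec}\left(D\mathcal R_{c^*}[s^*]\right)\setminus\{z\in\mathbb C:|z|\le\delta\}.$$ -/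

import Mathlib

open scoped Nat

noncomputable section

/-- The radius `ρ = 1.75` of the bidisk. -/
def rho : ℝ := 7 / 4

/-- The radius `ϱ₀ = 5.79833984375 × 10⁻⁴` of the ball around `s₀`. -/
def varrho0 : ℝ := 5.79833984375e-4

/-- `δ = 0.00124359130859375`. -/
def deltaBound : ℝ := 0.00124359130859375

/-- The Banach space `𝒜(ρ)` of power series `s(x,y) = ∑ c i j x^i y^j` with
`‖s‖ = ∑ |c i j| ρ^(i+j) < ∞`.  An element is stored as the summable family of the weighted
coefficients `c i j * ρ^(i+j)`, so that the norm of `ℓ¹` is the norm of `𝒜(ρ)`. -/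
abbrev FunSpace : Type := lp (fun _ : ℕ × ℕ => ℂ) 1

/-- The Taylor coefficient `c i j` of `s` at the origin. -/
def FunSpace.coeff (s : FunSpace) (i j : ℕ) : ℂ := s (i, j) / (rho : ℂ) ^ (i + j)

/-- The value `s(x,y) = ∑ c i j x^i y^j`, meaningful for `|x|, |y| ≤ ρ`. -/
def FunSpace.eval (s : FunSpace) (x y : ℂ) : ℂ :=
  ∑' p : ℕ × ℕ, s.coeff p.1 p.2 * x ^ p.1 * y ^ p.2

/-- The symmetric subspace `𝒜_s(ρ) = {s : ∂₁s(x,y) = ∂₁s(y,x)}`.  The coefficient of `x^i y^j`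
in `∂₁s(x,y)` is `(i+1) c (i+1) j`, in `∂₁s(y,x)` it is `(j+1) c (j+1) i`. -/
def symSubmodule : Submodule ℂ FunSpace where
  carrier := {s | ∀ i j : ℕ, ((i : ℂ) + 1) * s.coeff (i + 1) j = ((j : ℂ) + 1) * s.coeff (j + 1) i}
  zero_mem' := by
    intro i j
    simp [FunSpace.coeff]
  add_mem' := by
    intro a b ha hb i j
    have h1 := ha i j
    have h2 := hb i j
    simp only [FunSpace.coeff, lp.coeFn_add, Pi.add_apply, add_div, mul_add] at h1 h2 ⊢
    rw [h1, h2]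
  smul_mem' := by
    intro k a ha i j
    have h1 := ha i j
    simp only [FunSpace.coeff, lp.coeFn_smul, Pi.smul_apply, smul_eq_mul, mul_div_assoc] at h1 ⊢
    rw [mul_left_comm, h1, mul_left_comm]

/-- The Banach space `𝒜_s(1.75)`. -/
abbrev SymSpace : Type := symSubmodule

theorem FunSpace.continuous_coeff (i j : ℕ) : Continuous fun s : FunSpace => s.coeff i j := by
  have h : LipschitzWith 1 fun s : FunSpace => s (i, j) := by
    refine LipschitzWith.of_dist_le_mul fun s t => ?_
    rw [dist_eq_norm, dist_eq_norm, NNReal.coe_one, one_mul]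
    have := lp.norm_apply_le_norm (p := 1) one_ne_zero (s - t) (i, j)
    simpa using this
  exact h.continuous.div_const _

instance : CompleteSpace SymSpace := by
  have h : IsClosed (symSubmodule : Set FunSpace) := by
    have : (symSubmodule : Set FunSpace) = ⋂ (i : ℕ) (j : ℕ),
        {s : FunSpace | ((i : ℂ) + 1) * s.coeff (i + 1) j = ((j : ℂ) + 1) * s.coeff (j + 1) i} := by
      ext s
      simp only [Set.mem_iInter]
      rfl
    rw [this]
    exact isClosed_iInter fun i => isClosed_iInter fun j =>
      isClosed_eq (continuous_const.mul (FunSpace.continuous_coeff _ _))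
        (continuous_const.mul (FunSpace.continuous_coeff _ _))
  exact h.completeSpace_coe

/-- The value `s(x,y)` for `s ∈ 𝒜_s(ρ)`. -/
def ev (s : SymSpace) (x y : ℂ) : ℂ := FunSpace.eval s.1 x y

/-- `s` is a polynomial. -/
def IsPolynomial (s : SymSpace) : Prop := {p : ℕ × ℕ | s.1 p ≠ 0}.Finite

/-- The open bidisk `𝒟_r = {(x,y) : |x| < r, |y| < r}`. -/
def bidisk (r : ℝ) : Set (ℂ × ℂ) := {p | ‖p.1‖ < r ∧ ‖p.2‖ < r}

open Classical in
/-- The element of `𝒜_s(ρ)` whose restriction to `𝒟_ρ` is `f` (it is unique);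
`0` if there is none. -/
def ofFun (f : ℂ → ℂ → ℂ) : SymSpace :=
  if h : ∃ g : SymSpace, ∀ x y : ℂ, (x, y) ∈ bidisk rho → ev g x y = f x y
  then Classical.choose h else 0

/-- `Z[s](x,y)`, for `s ∈ U` and `(x,y) ∈ 𝒟_r`, is a continuous branch of simple solutions `z`, in
the disk `|z| < ρ`, of the midpoint equation `s(x,z) + s(y,z) = 0`. -/
structure IsMidpointBranch (U : Set SymSpace) (r : ℝ) (Z : SymSpace → ℂ × ℂ → ℂ) : Prop where
  r_pos : 0 < r
  r_le : r ≤ rho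
  cont : ContinuousOn (fun q : SymSpace × (ℂ × ℂ) => Z q.1 q.2) (U ×ˢ bidisk r)
  norm_lt : ∀ s ∈ U, ∀ p ∈ bidisk r, ‖Z s p‖ < rho
  midpoint : ∀ s ∈ U, ∀ p ∈ bidisk r, ev s p.1 (Z s p) + ev s p.2 (Z s p) = 0
  simple : ∀ s ∈ U, ∀ p ∈ bidisk r, deriv (fun z => ev s p.1 z + ev s p.2 z) (Z s p) ≠ 0

/-- The prerenormalization `𝒫_EKW[s] = s ∘ G[s]`, `G[s](x,y) = (Z[s](x,y), y)`. -/
def preEKW (Z : SymSpace → ℂ × ℂ → ℂ) (s : SymSpace) (x y : ℂ) : ℂ := ev s (Z s (x, y)) y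

/-- The Taylor coefficient `(s ∘ G[s])_(0,j)` at the origin. -/
def preCoeff (Z : SymSpace → ℂ × ℂ → ℂ) (s : SymSpace) (j : ℕ) : ℂ :=
  iteratedDeriv j (fun y => preEKW Z s 0 y) 0 / (j ! : ℂ)

/-- The prerenormalization with the change of coordinates of parameter `t = t[s]`:
`(1 + 2 t y) s(G[s](ξ_t(x,y)))`, `ξ_t(x,y) = (x + t x², y + t y²)`. -/
def pre (Z : SymSpace → ℂ × ℂ → ℂ) (t : SymSpace → ℂ) (s : SymSpace) (x y : ℂ) : ℂ :=
  (1 + 2 * t s * y) * preEKW Z s (x + t s * x ^ 2) (y + t s * y ^ 2)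

/-- The scaling `μ[s] = λ[s] ∂₁𝒫[s](λ[s],0)`. -/
def mu (Z : SymSpace → ℂ × ℂ → ℂ) (t lam : SymSpace → ℂ) (s : SymSpace) : ℂ :=
  lam s * deriv (fun x => pre Z t s x 0) (lam s)

/-- `λ[s]`, for `s ∈ U`, is a continuous branch of solutions of `𝒫[s](λ[s],0) = 0`, such that
`μ[s] ≠ 0` and `𝒫[s](λ[s] x, λ[s] y)` only involves values of `Z[s]` on `𝒟_r`
for `|x|, |y| ≤ ρ`. -/
structure IsScaling (U : Set SymSpace) (r : ℝ) (Z : SymSpace → ℂ × ℂ → ℂ)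
    (t lam : SymSpace → ℂ) : Prop where
  cont : ContinuousOn lam U
  domain : ∀ s ∈ U, ∀ x : ℂ, ‖x‖ ≤ rho → ‖lam s * x + t s * (lam s * x) ^ 2‖ < r
  zero : ∀ s ∈ U, pre Z t s (lam s) 0 = 0
  mu_ne_zero : ∀ s ∈ U, mu Z t lam s ≠ 0

/-- The renormalization operator `s ↦ μ[s]⁻¹ 𝒫[s](λ[s] x, λ[s] y)` on `𝒜_s(ρ)`. -/
def renorm (Z : SymSpace → ℂ × ℂ → ℂ) (t lam : SymSpace → ℂ) (s : SymSpace) : SymSpace :=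
  ofFun fun x y => (mu Z t lam s)⁻¹ * pre Z t s (lam s * x) (lam s * y)

/-- The operator `ℛ_EKW`: no change of coordinates. -/
def renormEKW (Z : SymSpace → ℂ × ℂ → ℂ) (lam : SymSpace → ℂ) : SymSpace → SymSpace :=
  renorm Z (fun _ => 0) lam

/-- The function `ψ(x,y) = s₁ x² + s₂ y² + 2 s y - s - (s₁ x + s₂ y)`, an eigenvector of
`Dℛ_EKW[s]` for the eigenvalue `λ[s]` at a fixed point `s` of `ℛ_EKW`. -/
def psiEKW (s : SymSpace) : SymSpace :=
  ofFun fun x y =>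
    deriv (fun x' => ev s x' y) x * x ^ 2 + deriv (fun y' => ev s x y') y * y ^ 2
      + 2 * ev s x y * y - ev s x y
      - (deriv (fun x' => ev s x' y) x * x + deriv (fun y' => ev s x y') y * y)

/-- The circle of centre `κ` and radius `ε` encloses no point of the spectrum of `L`
other than `κ`, and meets no point of it. -/
def Isolates (L : SymSpace →L[ℂ] SymSpace) (κ : ℂ) (ε : ℝ) : Prop :=
  0 < ε ∧ ∀ z ∈ spectrum ℂ L, ‖z - κ‖ ≤ ε → z = κ

/-- The Riesz projection `E(κ) = (2πi)⁻¹ ∮_{|z-κ|=ε} (z - L)⁻¹ dz`. -/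
def rieszProj (L : SymSpace →L[ℂ] SymSpace) (κ : ℂ) (ε : ℝ) : SymSpace →L[ℂ] SymSpace :=
  (2 * (Real.pi : ℂ) * Complex.I)⁻¹ • ∮ z in C(κ, ε), resolvent L z

/-- The parameter `t[s] = - λ_*⁻¹ ℓ(E(λ_*)(ℛ_EKW[s] - s^*))` of the operator `ℛ`, where
`λ_* = λ[s^*]` and `E(λ_*)` is the Riesz projection of `Dℛ_EKW[s^*]`.  Here `ℓ` is a
functional with `ℓ(ψ) = 1`: when `E(λ_*)` has rank one, `ℓ(E(λ_*) v)` is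
the coefficient `a` in `E(λ_*) v = a ψ`, of modulus `‖E(λ_*) v‖ / ‖ψ‖`. -/
def tRiesz (Z : SymSpace → ℂ × ℂ → ℂ) (lamE : SymSpace → ℂ) (sStar : SymSpace) (ε : ℝ)
    (l : SymSpace →L[ℂ] ℂ) (s : SymSpace) : ℂ :=
  -(lamE sStar)⁻¹ *
    l (rieszProj (fderiv ℂ (renormEKW Z lamE) sStar) (lamE sStar) ε (renormEKW Z lamE s - sStar))

/-- The parameter `t_c[s] = (c - (s ∘ G[s])_(0,3)) / (4 (s ∘ G[s])_(0,2))` of `ℛ_c`. -/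
def tCoeff (Z : SymSpace → ℂ × ℂ → ℂ) (c : ℂ) (s : SymSpace) : ℂ :=
  1 / 4 * ((c - preCoeff Z s 3) / preCoeff Z s 2)

end

open Filter Topology Metric
open scoped ContDiff

/-!
Both `ℛ` and `ℛ_{c^*}` are `ℛ_EKW` combined with a quadratic change of coordinates whose parameter
`t` vanishes at the fixed point `s^*`. Differentiating at `s^*`, the variations of `λ` and `μ`
contribute only an infinitesimal dilation and an infinitesimal multiplication, and the normalization
`s(1,0) = 0`, `∂₁s(1,0) = 1` of the image determines both from `Dt`, so that
`Dℛ_t v = Dℛ_EKW v + λ_* (Dt v) ψ`. The same bookkeeping shows `Dℛ_EKW ψ = λ_* ψ`. The Riesz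
projection therefore fixes `ψ`, whence `Dt ψ = -1` for the parameter of `ℛ` and `Dℛ ψ = 0`. Thus
`Dℛ` and `Dℛ_{c^*}` agree modulo the line spanned by their common eigenvector `ψ`, and the spectra
of two such operators can differ only in the two eigenvalues of that vector, here `0` and the
eigenvalue of `Dℛ_{c^*}`.

For the differentiability, `𝒫[s](λ[s] x, λ[s] y)` is holomorphic on a bidisk larger than `𝒟_ρ`, and
Cauchy's integral over a slightly larger torus realises it as an element of the weighted `ℓ¹` space
depending differentiably on the parameters.
-/

/-! ### Uniqueness of power series in one and two variables -/

theorem coeff_eq_zero_of_hasSum_pow_smul_zero {𝕜 E : Type*} [NontriviallyNormedField 𝕜]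
    [NormedAddCommGroup E] [NormedSpace 𝕜 E] {a : ℕ → E}
    (h : ∀ᶠ x in 𝓝 (0 : 𝕜), HasSum (fun n => x ^ n • a n) 0) (n : ℕ) : a n = 0 := by
  let P : FormalMultilinearSeries 𝕜 𝕜 E :=
    fun n => ContinuousMultilinearMap.mkPiRing 𝕜 (Fin n) (a n)
  have hcoeff (n : ℕ) : P.coeff n = a n := by simp [P, FormalMultilinearSeries.coeff]
  have hP : HasFPowerSeriesAt (0 : 𝕜 → E) P 0 :=
    hasFPowerSeriesAt_iff.2 (by simpa only [hcoeff, Pi.zero_apply] using h)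
  rw [← hcoeff, hP.eq_zero]
  rfl

theorem summable_mul_pow_mul_pow {c : ℕ × ℕ → ℂ} {q : ℝ}
    (hc : Summable fun p : ℕ × ℕ => ‖c p‖ * q ^ (p.1 + p.2)) {x y : ℂ} (hx : ‖x‖ ≤ q)
    (hy : ‖y‖ ≤ q) : Summable fun p : ℕ × ℕ => c p * x ^ p.1 * y ^ p.2 := by
  refine Summable.of_norm_bounded hc fun p => ?_
  have hq : 0 ≤ q := (norm_nonneg x).trans hx
  rw [norm_mul, norm_mul, norm_pow, norm_pow, mul_assoc, pow_add]
  gcongr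

theorem summable_mul_pow_row {c : ℕ × ℕ → ℂ} {q : ℝ} (hq : 0 < q)
    (hc : Summable fun p : ℕ × ℕ => ‖c p‖ * q ^ (p.1 + p.2)) (i : ℕ) {y : ℂ} (hy : ‖y‖ ≤ q) :
    Summable fun j => c (i, j) * y ^ j := by
  have hqi : (q : ℂ) ^ i ≠ 0 := pow_ne_zero _ (by exact_mod_cast hq.ne')
  have hrow : Summable fun j => c (i, j) * (q : ℂ) ^ i * y ^ j :=
    (summable_mul_pow_mul_pow hc (x := (q : ℂ)) (by simp [abs_of_pos hq]) hy).comp_injective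
      (Prod.mk_right_injective i)
  refine (hrow.mul_left ((q : ℂ) ^ i)⁻¹).congr fun j => ?_
  field_simp

theorem coeff_eq_zero_of_tsum_mul_pow_mul_pow_eq_zero {c : ℕ × ℕ → ℂ} {q : ℝ} (hq : 0 < q)
    (hc : Summable fun p : ℕ × ℕ => ‖c p‖ * q ^ (p.1 + p.2))
    (h : ∀ x y : ℂ, ‖x‖ < q → ‖y‖ < q → ∑' p : ℕ × ℕ, c p * x ^ p.1 * y ^ p.2 = 0)
    (i j : ℕ) : c (i, j) = 0 := by
  have hball : ∀ᶠ x in 𝓝 (0 : ℂ), ‖x‖ < q :=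
    continuous_norm.continuousAt.eventually_lt continuousAt_const (by simpa using hq)
  have hrow {y : ℂ} (hy : ‖y‖ < q) : ∑' j, c (i, j) * y ^ j = 0 := by
    refine coeff_eq_zero_of_hasSum_pow_smul_zero (𝕜 := ℂ)
      (a := fun i => ∑' j, c (i, j) * y ^ j) (hball.mono fun x hx => ?_) i
    have hsum := (summable_mul_pow_mul_pow hc hx.le hy.le).hasSum
    rw [h x y hx hy] at hsum
    exact hsum.prod_fiberwise fun i =>
      ((summable_mul_pow_row hq hc i hy.le).hasSum.mul_left (x ^ i)).congr_fun fun j => by ring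
  refine coeff_eq_zero_of_hasSum_pow_smul_zero (𝕜 := ℂ) (a := fun j => c (i, j))
    (hball.mono fun y hy => ?_) j
  rw [← hrow hy]
  exact (summable_mul_pow_row hq hc i hy.le).hasSum.congr_fun fun j => mul_comm _ _

/-! ### Evaluation on the space of power series -/

theorem rho_pos : 0 < rho := by norm_num [rho]

theorem rho_ne_zero : (rho : ℂ) ≠ 0 := by exact_mod_cast rho_pos.ne'

theorem norm_div_rho_lt_one_iff {x : ℂ} : ‖x / rho‖ < 1 ↔ ‖x‖ < rho := by
  rw [norm_div, Complex.norm_of_nonneg rho_pos.le, div_lt_one rho_pos]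

theorem bidisk_eq_ball (r : ℝ) : bidisk r = ball 0 r := by
  ext p; simp [bidisk, Prod.norm_def]

theorem mem_bidisk_iff {r : ℝ} {p : ℂ × ℂ} : p ∈ bidisk r ↔ ‖p‖ < r := by
  rw [bidisk_eq_ball, mem_ball_zero_iff]

theorem isOpen_bidisk (r : ℝ) : IsOpen (bidisk r) := bidisk_eq_ball r ▸ isOpen_ball

namespace FunSpace

theorem summable_norm (s : FunSpace) : Summable fun p => ‖s p‖ := by
  simpa using s.2.summable

theorem norm_eq_tsum (s : FunSpace) : ‖s‖ = ∑' p, ‖s p‖ := by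
  simp [lp.norm_eq_tsum_rpow (p := 1) (by simp) s]

theorem norm_coeff_mul_pow (s : FunSpace) (p : ℕ × ℕ) :
    ‖s.coeff p.1 p.2‖ * rho ^ (p.1 + p.2) = ‖s p‖ := by
  rw [coeff, norm_div, norm_pow, Complex.norm_of_nonneg rho_pos.le,
    div_mul_cancel₀ _ (pow_ne_zero _ rho_pos.ne')]

theorem summable_norm_coeff_mul_pow (s : FunSpace) :
    Summable fun p : ℕ × ℕ => ‖s.coeff p.1 p.2‖ * rho ^ (p.1 + p.2) := by
  simpa only [norm_coeff_mul_pow] using s.summable_norm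

theorem ext_coeff {s t : FunSpace} (h : ∀ i j, s.coeff i j = t.coeff i j) : s = t :=
  lp.ext (funext fun p => (div_left_inj' (pow_ne_zero _ rho_ne_zero)).1 (h p.1 p.2))

theorem coeff_mul_pow_mul_pow (s : FunSpace) (x y : ℂ) (p : ℕ × ℕ) :
    s.coeff p.1 p.2 * x ^ p.1 * y ^ p.2 = (x / rho) ^ p.1 * ((y / rho) ^ p.2 * s p) := by
  have := rho_ne_zero
  simp only [coeff, pow_add, div_pow]
  field_simp

/-- Reindexing of the weighted coefficients along an injective map, as an operator of norm at
most one. -/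
noncomputable def compInj (f : ℕ × ℕ → ℕ × ℕ) (hf : f.Injective) : FunSpace →L[ℂ] FunSpace :=
  LinearMap.mkContinuous
    { toFun := fun s => ⟨fun p => s (f p), memℓp_gen (by
        simpa [Function.comp_def] using s.summable_norm.comp_injective hf)⟩
      map_add' := fun _ _ => rfl
      map_smul' := fun _ _ => rfl } 1 (fun s => by
        rw [one_mul, norm_eq_tsum, norm_eq_tsum]
        exact (s.summable_norm.comp_injective hf).tsum_le_tsum_of_inj f hf
          (fun _ _ => norm_nonneg _) (fun _ => le_rfl) s.summable_norm)

theorem norm_compInj_le (f : ℕ × ℕ → ℕ × ℕ) (hf : f.Injective) : ‖compInj f hf‖ ≤ 1 :=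
  LinearMap.mkContinuous_norm_le _ zero_le_one _

theorem compInj_pow_apply (f : ℕ × ℕ → ℕ × ℕ) (hf : f.Injective) (n : ℕ) (s : FunSpace)
    (p : ℕ × ℕ) : (compInj f hf ^ n) s p = s (f^[n] p) := by
  induction n generalizing p with
  | zero => rfl
  | succ n ih =>
    rw [pow_succ', Function.iterate_succ_apply]
    exact ih (f p)

/-- The backward shift `s ↦ ρ (s(x,y) - s(0,y)) / x`. -/
noncomputable def shiftFst : FunSpace →L[ℂ] FunSpace :=
  compInj (Prod.map Nat.succ id) (Nat.succ_injective.prodMap Function.injective_id)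

/-- The backward shift `s ↦ ρ (s(x,y) - s(x,0)) / y`. -/
noncomputable def shiftSnd : FunSpace →L[ℂ] FunSpace :=
  compInj (Prod.map id Nat.succ) (Function.injective_id.prodMap Nat.succ_injective)

theorem norm_shiftFst_le : ‖shiftFst‖ ≤ 1 := norm_compInj_le _ _

theorem norm_shiftSnd_le : ‖shiftSnd‖ ≤ 1 := norm_compInj_le _ _

theorem shiftFst_pow_apply (n : ℕ) (s : FunSpace) (p : ℕ × ℕ) :
    (shiftFst ^ n) s p = s (p.1 + n, p.2) := by
  rw [shiftFst, compInj_pow_apply, Prod.map_iterate]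
  simp [Prod.map, Nat.succ_iterate]

theorem shiftSnd_pow_apply (n : ℕ) (s : FunSpace) (p : ℕ × ℕ) :
    (shiftSnd ^ n) s p = s (p.1, p.2 + n) := by
  rw [shiftSnd, compInj_pow_apply, Prod.map_iterate]
  simp [Prod.map, Nat.succ_iterate]

section NeumannSeries

variable {S : FunSpace →L[ℂ] FunSpace} {x : ℂ}

theorem norm_div_rho_smul_lt_one (hS : ‖S‖ ≤ 1) (hx : ‖x‖ < rho) : ‖(x / rho) • S‖ < 1 := by
  rw [norm_smul]
  exact mul_lt_one_of_nonneg_of_lt_one_left (norm_nonneg _) (norm_div_rho_lt_one_iff.2 hx) hS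

theorem hasSum_inverse_one_sub_apply (hS : ‖S‖ ≤ 1) (hx : ‖x‖ < rho) (s : FunSpace)
    (p : ℕ × ℕ) :
    HasSum (fun n => (x / rho) ^ n * (S ^ n) s p) (Ring.inverse (1 - (x / rho : ℂ) • S) s p) := by
  have hlt := norm_div_rho_smul_lt_one hS hx
  have hgeom := (summable_geometric_of_norm_lt_one hlt).hasSum
  rw [geom_series_eq_inverse _ hlt] at hgeom
  refine (hgeom.mapL ((lp.evalCLM ℂ (fun _ : ℕ × ℕ => ℂ) 1 p).comp
    (ContinuousLinearMap.apply ℂ FunSpace s))).congr_fun fun n => ?_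
  rw [smul_pow]
  rfl

theorem contDiffAt_inverse_one_sub {n : WithTop ℕ∞} (hS : ‖S‖ ≤ 1) (hx : ‖x‖ < rho) :
    ContDiffAt ℂ n (fun x : ℂ => Ring.inverse (1 - (x / rho : ℂ) • S)) x :=
  ContDiffAt.comp x (f := fun x : ℂ => 1 - (x / rho : ℂ) • S)
    (contDiffAt_ringInverse ℂ (Units.oneSub _ (norm_div_rho_smul_lt_one hS hx))) (by fun_prop)

end NeumannSeries

/-- Evaluation at `p`, for `‖p‖ < ρ`, as a continuous linear functional.  Written with the
Neumann series of the two backward shifts, it visibly depends smoothly on `p`. -/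
noncomputable def evalL (p : ℂ × ℂ) : FunSpace →L[ℂ] ℂ :=
  (lp.evalCLM ℂ (fun _ : ℕ × ℕ => ℂ) 1 (0, 0)).comp
    ((Ring.inverse (1 - (p.1 / rho : ℂ) • shiftFst)).comp
      (Ring.inverse (1 - (p.2 / rho : ℂ) • shiftSnd)))

theorem evalL_apply {p : ℂ × ℂ} (hp : ‖p‖ < rho) (s : FunSpace) :
    evalL p s = s.eval p.1 p.2 := by
  have hp₁ : ‖p.1‖ < rho := (norm_fst_le p).trans_lt hp
  have hp₂ : ‖p.2‖ < rho := (norm_snd_le p).trans_lt hp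
  refine (hasSum_inverse_one_sub_apply norm_shiftFst_le hp₁ _ (0, 0)).unique <|
    (summable_mul_pow_mul_pow s.summable_norm_coeff_mul_pow hp₁.le hp₂.le).hasSum.prod_fiberwise
      fun i => ?_
  rw [shiftFst_pow_apply, zero_add]
  refine ((hasSum_inverse_one_sub_apply norm_shiftSnd_le hp₂ s (i, 0)).mul_left
    ((p.1 / rho) ^ i)).congr_fun fun j => ?_
  rw [coeff_mul_pow_mul_pow s p.1 p.2 (i, j), shiftSnd_pow_apply, zero_add]

theorem contDiffAt_evalL {n : WithTop ℕ∞} {p : ℂ × ℂ} (hp : ‖p‖ < rho) :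
    ContDiffAt ℂ n evalL p :=
  contDiffAt_const.clm_comp <|
    ((contDiffAt_inverse_one_sub norm_shiftFst_le ((norm_fst_le p).trans_lt hp)).comp p
      contDiffAt_fst).clm_comp
    ((contDiffAt_inverse_one_sub norm_shiftSnd_le ((norm_snd_le p).trans_lt hp)).comp p
      contDiffAt_snd)

theorem ext_eval {s t : FunSpace}
    (h : ∀ p : ℂ × ℂ, ‖p‖ < rho → s.eval p.1 p.2 = t.eval p.1 p.2) : s = t := by
  rw [← sub_eq_zero]
  refine ext_coeff fun i j => ?_
  rw [show (0 : FunSpace).coeff i j = 0 by simp [coeff]]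
  refine coeff_eq_zero_of_tsum_mul_pow_mul_pow_eq_zero (c := fun p => (s - t).coeff p.1 p.2)
    rho_pos (s - t).summable_norm_coeff_mul_pow (fun x y hx hy => ?_) i j
  have hp : ‖((x, y) : ℂ × ℂ)‖ < rho := max_lt hx hy
  have heval := evalL_apply hp (s - t)
  rw [map_sub, evalL_apply hp, evalL_apply hp, h _ hp, sub_self] at heval
  exact heval.symm

end FunSpace

/-! ### Holomorphic families of functions on a polydisk, as families in `FunSpace` -/

section ParametricIntegral

open MeasureTheory

variable {𝕜 H E α : Type*} [RCLike 𝕜] [NormedAddCommGroup H] [NormedSpace 𝕜 H]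
  [NormedAddCommGroup E] [NormedSpace ℝ E] [NormedSpace 𝕜 E]
  [TopologicalSpace α] [MeasurableSpace α] [OpensMeasurableSpace α] [T2Space α]
  {μ : Measure α} [IsFiniteMeasureOnCompacts μ]

theorem exists_eventually_forall_norm_le_of_isCompact {X Y F : Type*} [TopologicalSpace X]
    [TopologicalSpace Y] [SeminormedAddCommGroup F] {K : Set Y} (hK : IsCompact K)
    {f : X × Y → F} {x₀ : X} (hf : ∀ y ∈ K, ContinuousAt f (x₀, y)) :
    ∃ C : ℝ, ∀ᶠ x in 𝓝 x₀, ∀ y ∈ K, ‖f (x, y)‖ ≤ C := by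
  obtain ⟨C, hC⟩ := hK.exists_bound_of_continuousOn (f := fun y => f (x₀, y)) fun y hy =>
    ((hf y hy).comp (f := fun y => (x₀, y)) (by fun_prop)).continuousWithinAt
  refine ⟨C + 1, hK.eventually_forall_of_forall_eventually fun y hy => ?_⟩
  have hlt : ‖f (x₀, y)‖ < C + 1 := (hC y hy).trans_lt (lt_add_one C)
  exact ((hf y hy).norm.eventually_lt continuousAt_const hlt).mono fun z hz => hz.le

theorem hasFDerivAt_setIntegral_of_isCompact {K : Set α} (hK : IsCompact K) {F : H → α → E}
    {F' : H → α → H →L[𝕜] E} {x₀ : H} (hF : ∀ᶠ x in 𝓝 x₀, ContinuousOn (F x) K)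
    (hF' : ∀ a ∈ K, ContinuousAt (Function.uncurry F') (x₀, a))
    (hderiv : ∀ᶠ x in 𝓝 x₀, ∀ a ∈ K, HasFDerivAt (F · a) (F' x a) x) :
    HasFDerivAt (fun x => ∫ a in K, F x a ∂μ) (∫ a in K, F' x₀ a ∂μ) x₀ := by
  obtain ⟨C, hC⟩ := exists_eventually_forall_norm_le_of_isCompact hK hF'
  have hF'₀ : ContinuousOn (F' x₀) K := fun a ha =>
    ((hF' a ha).comp (f := fun a => (x₀, a)) (by fun_prop)).continuousWithinAt
  have hK_ae {P : α → Prop} (h : ∀ a ∈ K, P a) : ∀ᵐ a ∂μ.restrict K, P a :=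
    (ae_restrict_iff' hK.measurableSet).2 (Eventually.of_forall h)
  exact hasFDerivAt_integral_of_dominated_of_fderiv_le (bound := fun _ => C) (hC.and hderiv)
    (hF.mono fun x hx => hx.aestronglyMeasurable_of_isCompact hK hK.measurableSet)
    (hF.self_of_nhds.integrableOn_compact hK)
    (hF'₀.aestronglyMeasurable_of_isCompact hK hK.measurableSet)
    (hK_ae fun a ha x hx => hx.1 a ha) (integrableOn_const hK.measure_lt_top.ne)
    (hK_ae fun a ha x hx => hx.2 a ha)

end ParametricIntegral

section CauchyFormula

open MeasureTheory

variable {E : Type*} [NormedAddCommGroup E] [NormedSpace ℂ E] [CompleteSpace E] {R : ℝ}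

theorem integral_circleMap_cauchy {f : ℂ → E} (hf : DifferentiableOn ℂ f (closedBall 0 R))
    {w : ℂ} (hw : ‖w‖ < R) :
    ∫ θ in Set.Icc (0 : ℝ) (2 * Real.pi), (1 - w / circleMap 0 R θ)⁻¹ • f (circleMap 0 R θ) =
      (2 * Real.pi) • f w := by
  have hR : 0 < R := (norm_nonneg w).trans_lt hw
  have hmean : Real.circleAverage (fun z => (z / (z - w)) • f z) 0 R = f w := by
    simpa using (hf.diffContOnCl_ball (c := 0) (R := |R|) (by rw [abs_of_pos hR])
      ).circleAverage_smul_div (w := w) (R := R) (by simpa [abs_of_pos hR] using hw)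
  rw [← hmean, Real.circleAverage_def, smul_inv_smul₀ Real.two_pi_pos.ne',
    intervalIntegral.integral_of_le Real.two_pi_pos.le, integral_Icc_eq_integral_Ioc]
  refine integral_congr_ae (Eventually.of_forall fun θ => ?_)
  have hz : circleMap 0 R θ ≠ 0 := circleMap_ne_center hR.ne'
  simp only [one_sub_div hz, inv_div]

/-- The parametrization by angles of the product of two circles of radius `R` around `0`. -/
noncomputable def bicircleMap (R : ℝ) (θ : ℝ × ℝ) : ℂ × ℂ :=
  (circleMap 0 R θ.1, circleMap 0 R θ.2)

/-- The domain of the angles in `bicircleMap`. -/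
noncomputable def angleSquare : Set (ℝ × ℝ) :=
  Set.Icc 0 (2 * Real.pi) ×ˢ Set.Icc 0 (2 * Real.pi)

theorem isCompact_angleSquare : IsCompact angleSquare := isCompact_Icc.prod isCompact_Icc

theorem continuous_bicircleMap (R : ℝ) : Continuous (bicircleMap R) :=
  ((continuous_circleMap 0 R).comp continuous_fst).prodMk
    ((continuous_circleMap 0 R).comp continuous_snd)

theorem bicircleMap_mem_closedBall (hR : 0 ≤ R) (θ : ℝ × ℝ) :
    bicircleMap R θ ∈ closedBall 0 R := by
  simp [bicircleMap, Prod.norm_def, abs_of_nonneg hR]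

theorem one_sub_div_ne_zero_of_norm_lt {w z : ℂ} (h : ‖w‖ < ‖z‖) : 1 - w / z ≠ 0 := by
  rw [sub_ne_zero]
  rintro hwz
  rw [eq_div_iff (norm_pos_iff.1 ((norm_nonneg w).trans_lt h)), one_mul] at hwz
  exact h.ne (congrArg norm hwz.symm)

theorem continuous_one_sub_div_circleMap_inv {w : ℂ} (hw : ‖w‖ < R) :
    Continuous fun θ => (1 - w / circleMap 0 R θ)⁻¹ := by
  have hR : 0 < R := (norm_nonneg w).trans_lt hw
  exact (continuous_const.sub (continuous_const.div (continuous_circleMap 0 R)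
    fun θ => circleMap_ne_center hR.ne')).inv₀
    fun θ => one_sub_div_ne_zero_of_norm_lt (by simpa [abs_of_pos hR] using hw)

theorem integral_bicircleMap_cauchy {f : ℂ × ℂ → E} (hf : DifferentiableOn ℂ f (closedBall 0 R))
    {p : ℂ × ℂ} (hp : ‖p‖ < R) :
    ∫ θ in angleSquare, ((1 - p.1 / (bicircleMap R θ).1)⁻¹ * (1 - p.2 / (bicircleMap R θ).2)⁻¹) •
      f (bicircleMap R θ) = (2 * Real.pi) ^ 2 • f p := by
  have hR : 0 < R := (norm_nonneg p).trans_lt hp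
  have hp₁ : ‖p.1‖ < R := (norm_fst_le p).trans_lt hp
  have hp₂ : ‖p.2‖ < R := (norm_snd_le p).trans_lt hp
  have hcont : Continuous fun θ => ((1 - p.1 / (bicircleMap R θ).1)⁻¹ *
      (1 - p.2 / (bicircleMap R θ).2)⁻¹) • f (bicircleMap R θ) :=
    (((continuous_one_sub_div_circleMap_inv hp₁).comp continuous_fst).mul
      ((continuous_one_sub_div_circleMap_inv hp₂).comp continuous_snd)).smul
      (hf.continuousOn.comp_continuous (continuous_bicircleMap R)
        (bicircleMap_mem_closedBall hR.le))
  have hslice_snd (θ : ℝ) :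
      DifferentiableOn ℂ (fun w => f (circleMap 0 R θ, w)) (closedBall 0 R) :=
    hf.comp (f := fun w => (circleMap 0 R θ, w)) (by fun_prop) fun w hw => by
      simpa [Prod.norm_def, abs_of_pos hR] using hw
  have hslice_fst : DifferentiableOn ℂ (fun z => f (z, p.2)) (closedBall 0 R) :=
    hf.comp (f := fun z => (z, p.2)) (by fun_prop) fun z hz => by
      simpa [Prod.norm_def, hp₂.le] using hz
  have hint := hcont.continuousOn.integrableOn_compact (μ := volume) isCompact_angleSquare
  rw [angleSquare, Measure.volume_eq_prod] at hint ⊢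
  rw [setIntegral_prod _ hint]
  have hinner (θ : ℝ) : ∫ η in Set.Icc (0 : ℝ) (2 * Real.pi),
      ((1 - p.1 / circleMap 0 R θ)⁻¹ * (1 - p.2 / circleMap 0 R η)⁻¹) •
        f (circleMap 0 R θ, circleMap 0 R η) =
      (2 * Real.pi) • (1 - p.1 / circleMap 0 R θ)⁻¹ • f (circleMap 0 R θ, p.2) := by
    simp_rw [mul_smul (1 - p.1 / circleMap 0 R θ)⁻¹]
    rw [integral_smul, integral_circleMap_cauchy (hslice_snd θ) hp₂, smul_comm]
  simp_rw [bicircleMap, hinner]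
  rw [integral_smul, integral_circleMap_cauchy hslice_fst hp₁, smul_smul, ← sq]

end CauchyFormula

namespace FunSpace

/-- The function `(1 - x / a)⁻¹ (1 - y / b)⁻¹` for `z = (a, b)` with `|a|, |b| > ρ`. -/
noncomputable def cauchyKernel (z : ℂ × ℂ) : FunSpace :=
  ∑' p : ℕ × ℕ, ((rho / z.1) ^ p.1 * (rho / z.2) ^ p.2) • (lp.single 1 p (1 : ℂ) : FunSpace)

section CauchyKernel

variable {R : ℝ}

theorem norm_rho_div_le {a : ℂ} (hR : 0 < R) (ha : R ≤ ‖a‖) : ‖rho / a‖ ≤ rho / R := by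
  rw [norm_div, Complex.norm_of_nonneg rho_pos.le]
  exact div_le_div_of_nonneg_left rho_pos.le hR ha

theorem norm_cauchyKernel_term_le {z : ℂ × ℂ} (hR : 0 < R) (hz₁ : R ≤ ‖z.1‖) (hz₂ : R ≤ ‖z.2‖)
    (p : ℕ × ℕ) :
    ‖((rho / z.1) ^ p.1 * (rho / z.2) ^ p.2) • (lp.single 1 p (1 : ℂ) : FunSpace)‖ ≤
      (rho / R) ^ p.1 * (rho / R) ^ p.2 := by
  rw [norm_smul, lp.norm_single (by norm_num), norm_one, mul_one, norm_mul, norm_pow, norm_pow]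
  have := rho_pos
  gcongr <;> exact norm_rho_div_le hR ‹_›

theorem summable_rho_div_pow_mul_pow (hR : rho < R) :
    Summable fun p : ℕ × ℕ => (rho / R) ^ p.1 * (rho / R) ^ p.2 := by
  have h₀ : 0 ≤ rho / R := div_nonneg rho_pos.le (rho_pos.trans hR).le
  have hgeom := summable_geometric_of_lt_one h₀ ((div_lt_one (rho_pos.trans hR)).2 hR)
  exact hgeom.mul_of_nonneg hgeom (fun _ => pow_nonneg h₀ _) fun _ => pow_nonneg h₀ _

theorem continuousOn_cauchyKernel (hR : rho < R) :
    ContinuousOn cauchyKernel {z | R ≤ ‖z.1‖ ∧ R ≤ ‖z.2‖} := by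
  have hR₀ : 0 < R := rho_pos.trans hR
  have hne {a : ℂ} (ha : R ≤ ‖a‖) : a ≠ 0 := norm_pos_iff.1 (hR₀.trans_le ha)
  refine continuousOn_tsum (fun p => ?_) (summable_rho_div_pow_mul_pow hR)
    fun p z hz => norm_cauchyKernel_term_le hR₀ hz.1 hz.2 p
  exact (((continuousOn_const.div continuousOn_fst fun z hz => hne hz.1).pow _).mul
    ((continuousOn_const.div continuousOn_snd fun z hz => hne hz.2).pow _)).smul continuousOn_const

theorem eval_single (p : ℕ × ℕ) (x y : ℂ) :
    eval (lp.single 1 p (1 : ℂ)) x y = (x / rho) ^ p.1 * (y / rho) ^ p.2 := by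
  rw [eval, tsum_eq_single p fun p' hp' => by rw [coeff_mul_pow_mul_pow]; simp [hp'],
    coeff_mul_pow_mul_pow]
  simp

theorem evalL_cauchyKernel {p z : ℂ × ℂ} (hp : ‖p‖ < rho) (hR : rho < R) (hz₁ : R ≤ ‖z.1‖)
    (hz₂ : R ≤ ‖z.2‖) :
    evalL p (cauchyKernel z) = (1 - p.1 / z.1)⁻¹ * (1 - p.2 / z.2)⁻¹ := by
  have hlt {w a : ℂ} (hw : ‖w‖ < rho) (ha : R ≤ ‖a‖) : ‖w / a‖ < 1 := by
    rw [norm_div, div_lt_one ((rho_pos.trans hR).trans_le ha)]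
    exact (hw.trans hR).trans_le ha
  have h₁ := hlt ((norm_fst_le p).trans_lt hp) hz₁
  have h₂ := hlt ((norm_snd_le p).trans_lt hp) hz₂
  have hkernel := (Summable.of_norm_bounded (summable_rho_div_pow_mul_pow hR)
    (norm_cauchyKernel_term_le (rho_pos.trans hR) hz₁ hz₂)).hasSum.mapL (evalL p)
  have hgeom : HasSum (fun i : ℕ × ℕ => (p.1 / z.1) ^ i.1 * (p.2 / z.2) ^ i.2)
      ((1 - p.1 / z.1)⁻¹ * (1 - p.2 / z.2)⁻¹) :=
    (hasSum_geometric_of_norm_lt_one h₁).mul (hasSum_geometric_of_norm_lt_one h₂)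
      (summable_mul_of_summable_norm (summable_norm_geometric_of_norm_lt_one h₁)
        (summable_norm_geometric_of_norm_lt_one h₂))
  refine hkernel.unique (hgeom.congr_fun fun i => ?_)
  have := rho_ne_zero
  rw [map_smul, evalL_apply hp, eval_single, smul_eq_mul]
  simp only [div_pow]
  field_simp

end CauchyKernel

section CauchyTransform

open MeasureTheory

variable {R : ℝ}

/-- The element of `FunSpace` that the Cauchy formula on the polydisk of radius `R > ρ`
associates with a function on the polydisk. -/
noncomputable def cauchyTransform (R : ℝ) (f : ℂ × ℂ → ℂ) : FunSpace :=
  ((2 * Real.pi) ^ 2)⁻¹ •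
    ∫ θ in angleSquare, f (bicircleMap R θ) • cauchyKernel (bicircleMap R θ)

theorem continuous_cauchyKernel_bicircleMap (hR : rho < R) :
    Continuous fun θ => cauchyKernel (bicircleMap R θ) :=
  (continuousOn_cauchyKernel hR).comp_continuous (continuous_bicircleMap R) fun θ => by
    simp [bicircleMap, abs_of_pos (rho_pos.trans hR)]

theorem continuous_smul_cauchyKernel {f : ℂ × ℂ → ℂ} (hR : rho < R)
    (hf : ContinuousOn f (closedBall 0 R)) :
    Continuous fun θ => f (bicircleMap R θ) • cauchyKernel (bicircleMap R θ) :=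
  (hf.comp_continuous (continuous_bicircleMap R)
    (bicircleMap_mem_closedBall (rho_pos.trans hR).le)).smul
    (continuous_cauchyKernel_bicircleMap hR)

theorem eval_cauchyTransform (hR : rho < R) {f : ℂ × ℂ → ℂ}
    (hf : DifferentiableOn ℂ f (closedBall 0 R)) {p : ℂ × ℂ} (hp : ‖p‖ < rho) :
    (cauchyTransform R f).eval p.1 p.2 = f p := by
  have hnorm (θ : ℝ) : R ≤ ‖circleMap 0 R θ‖ := by simp [abs_of_pos (rho_pos.trans hR)]
  have hint := (continuous_smul_cauchyKernel hR hf.continuousOn).continuousOn.integrableOn_compact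
    (μ := volume) isCompact_angleSquare
  rw [← evalL_apply hp, cauchyTransform, ContinuousLinearMap.map_smul_of_tower,
    ← ContinuousLinearMap.integral_comp_comm _ hint,
    inv_smul_eq_iff₀ (pow_ne_zero 2 Real.two_pi_pos.ne'),
    ← integral_bicircleMap_cauchy hf (hp.trans hR)]
  refine integral_congr_ae (Eventually.of_forall fun θ => ?_)
  simp only [map_smul, smul_eq_mul, mul_comm (f _),
    evalL_cauchyKernel (z := bicircleMap R θ) hp hR (hnorm θ.1) (hnorm θ.2)]

variable {E : Type*} [NormedAddCommGroup E] [NormedSpace ℂ E] {F : E × (ℂ × ℂ) → ℂ}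
  {O : Set (E × (ℂ × ℂ))} {e₀ : E}

theorem differentiableAt_cauchyTransform (hR : rho < R) (hO : IsOpen O)
    (hF : ContDiffOn ℂ 1 F O) (hmem : ∀ᶠ e in 𝓝 e₀, ∀ p ∈ closedBall 0 R, (e, p) ∈ O) :
    DifferentiableAt ℂ (fun e => cauchyTransform R fun p => F (e, p)) e₀ := by
  have hR₀ : 0 ≤ R := (rho_pos.trans hR).le
  have hker := continuous_cauchyKernel_bicircleMap hR
  let F' : E → ℝ × ℝ → E →L[ℂ] FunSpace := fun e θ =>
    ((fderiv ℂ F (e, bicircleMap R θ)).comp (.inl ℂ E (ℂ × ℂ))).smulRight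
      (cauchyKernel (bicircleMap R θ))
  refine (hasFDerivAt_setIntegral_of_isCompact (F' := F') isCompact_angleSquare ?_ ?_
    ?_).differentiableAt.fun_const_smul _
  · filter_upwards [hmem] with e he
    exact (continuous_smul_cauchyKernel hR
      (hF.continuousOn.comp (by fun_prop) fun p hp => he p hp)).continuousOn
  · intro θ _
    have hbicircle : Continuous fun z : E × (ℝ × ℝ) => (z.1, bicircleMap R z.2) :=
      continuous_fst.prodMk ((continuous_bicircleMap R).comp continuous_snd)
    have hfderiv : ContinuousAt (fun z : E × (ℝ × ℝ) => fderiv ℂ F (z.1, bicircleMap R z.2))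
        (e₀, θ) :=
      ((hF.continuousOn_fderiv_of_isOpen hO le_rfl).continuousAt (hO.mem_nhds
        (hmem.self_of_nhds _ (bicircleMap_mem_closedBall hR₀ θ)))).comp
        (f := fun z : E × (ℝ × ℝ) => (z.1, bicircleMap R z.2)) hbicircle.continuousAt
    exact ((ContinuousLinearMap.smulRightL ℂ E FunSpace).continuous.continuousAt.comp
      (hfderiv.clm_comp continuousAt_const)).clm_apply (hker.comp continuous_snd).continuousAt
  · filter_upwards [hmem] with e he θ _
    have hdiff : DifferentiableAt ℂ F (e, bicircleMap R θ) :=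
      (hF.contDiffAt (hO.mem_nhds (he _ (bicircleMap_mem_closedBall hR₀ θ)))).differentiableAt
        one_ne_zero
    exact (hdiff.hasFDerivAt.comp e (hasFDerivAt_prodMk_left e _)).smul_const _

theorem exists_differentiableAt_eval_eq (hO : IsOpen O)
    (hmem : ∀ p : ℂ × ℂ, ‖p‖ ≤ rho → (e₀, p) ∈ O) (hF : ContDiffOn ℂ 1 F O) :
    ∃ Φ : E → FunSpace, DifferentiableAt ℂ Φ e₀ ∧
      ∀ᶠ e in 𝓝 e₀, ∀ p : ℂ × ℂ, ‖p‖ < rho → (Φ e).eval p.1 p.2 = F (e, p) := by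
  obtain ⟨δ, hδ, hthick⟩ := (isCompact_closedBall (0 : ℂ × ℂ) rho).exists_cthickening_subset_open
    (hO.preimage (by fun_prop : Continuous fun p : ℂ × ℂ => (e₀, p)))
    fun p hp => hmem p (mem_closedBall_zero_iff.1 hp)
  rw [cthickening_closedBall hδ.le rho_pos.le] at hthick
  have hR : rho < δ + rho := lt_add_of_pos_left rho hδ
  have hmem' : ∀ᶠ e in 𝓝 e₀, ∀ p ∈ closedBall 0 (δ + rho), (e, p) ∈ O :=
    (isCompact_closedBall 0 _).eventually_forall_of_forall_eventually fun p hp =>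
      hO.mem_nhds (hthick hp)
  refine ⟨_, differentiableAt_cauchyTransform hR hO hF hmem', ?_⟩
  filter_upwards [hmem'] with e he p hp
  exact eval_cauchyTransform hR (f := fun p => F (e, p))
    ((hF.differentiableOn one_ne_zero).comp (by fun_prop) fun p hp => he p hp) hp

end CauchyTransform

end FunSpace

/-! ### The symmetric subspace -/

theorem exists_natCast_mul_pow_pred_le {q R : ℝ} (hq : 0 < q) (hqR : q < R) :
    ∃ K : ℝ, 0 ≤ K ∧ ∀ i : ℕ, (i : ℝ) * q ^ (i - 1) ≤ K * R ^ i := by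
  have hR : 0 < R := hq.trans hqR
  have hratio : ‖q / R‖ < 1 := by
    rwa [Real.norm_of_nonneg (div_pos hq hR).le, div_lt_one hR]
  have hsum : Summable fun n : ℕ => (n : ℝ) * (q / R) ^ n := by
    simpa using summable_pow_mul_geometric_of_norm_lt_one 1 hratio
  have hnonneg (n : ℕ) : 0 ≤ (n : ℝ) * (q / R) ^ n := by positivity
  refine ⟨(∑' n : ℕ, (n : ℝ) * (q / R) ^ n) / q, div_nonneg (tsum_nonneg hnonneg) hq.le,
    fun i => ?_⟩
  calc (i : ℝ) * q ^ (i - 1) = (i : ℝ) * (q / R) ^ i / q * R ^ i := by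
        rcases i with _ | i
        · simp
        · rw [Nat.add_sub_cancel, div_pow, pow_succ q]
          field_simp
    _ ≤ (∑' n : ℕ, (n : ℝ) * (q / R) ^ n) / q * R ^ i := by
        gcongr
        exact hsum.le_tsum i fun j _ => hnonneg j

namespace FunSpace

/-- The Taylor coefficient of `x ^ p.1 * y ^ p.2` in the partial derivative `∂₁ s`. -/
noncomputable def derivCoeff (s : FunSpace) (p : ℕ × ℕ) : ℂ :=
  ((p.1 : ℂ) + 1) * s.coeff (p.1 + 1) p.2

theorem injective_map_succ_fst : Function.Injective (Prod.map Nat.succ id : ℕ × ℕ → ℕ × ℕ) :=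
  Nat.succ_injective.prodMap Function.injective_id

theorem summable_derivCoeff (s : FunSpace) {q : ℝ} (hq : 0 < q) (hqr : q < rho) :
    Summable fun p : ℕ × ℕ => ‖s.derivCoeff p‖ * q ^ (p.1 + p.2) := by
  obtain ⟨K, hK₀, hK⟩ := exists_natCast_mul_pow_pred_le hq hqr
  refine Summable.of_nonneg_of_le (fun p => by positivity) (fun p => ?_)
    ((s.summable_norm_coeff_mul_pow.comp_injective injective_map_succ_fst).mul_left K)
  have hKp : ((p.1 : ℝ) + 1) * q ^ p.1 ≤ K * rho ^ (p.1 + 1) := by simpa using hK (p.1 + 1)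
  have hnorm : ‖(p.1 : ℂ) + 1‖ = (p.1 : ℝ) + 1 := by
    exact_mod_cast Complex.norm_natCast (p.1 + 1)
  have := rho_pos
  calc ‖s.derivCoeff p‖ * q ^ (p.1 + p.2)
      = ‖s.coeff (p.1 + 1) p.2‖ * ((((p.1 : ℝ) + 1) * q ^ p.1) * q ^ p.2) := by
        rw [derivCoeff, norm_mul, hnorm, pow_add]; ring
    _ ≤ ‖s.coeff (p.1 + 1) p.2‖ * ((K * rho ^ (p.1 + 1)) * rho ^ p.2) := by gcongr
    _ = K * (‖s.coeff (p.1 + 1) p.2‖ * rho ^ ((p.1 + 1) + p.2)) := by rw [pow_add]; ring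

theorem tsum_coeff_mul_deriv_pow (s : FunSpace) (x y : ℂ) :
    ∑' p : ℕ × ℕ, s.coeff p.1 p.2 * (p.1 * x ^ (p.1 - 1)) * y ^ p.2 =
      ∑' p : ℕ × ℕ, s.derivCoeff p * x ^ p.1 * y ^ p.2 := by
  rw [← injective_map_succ_fst.tsum_eq]
  · refine tsum_congr fun p => ?_
    simp only [derivCoeff, Prod.map, Nat.succ_eq_add_one, Nat.add_sub_cancel, id, Nat.cast_add,
      Nat.cast_one]
    ring
  · rintro ⟨_ | i, j⟩ h
    · simp at h
    · exact ⟨(i, j), rfl⟩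

theorem hasDerivAt_eval_fst (s : FunSpace) {x y : ℂ} (hx : ‖x‖ < rho) (hy : ‖y‖ < rho) :
    HasDerivAt (fun x => s.eval x y) (∑' p : ℕ × ℕ, s.derivCoeff p * x ^ p.1 * y ^ p.2) x := by
  obtain ⟨q, hxq, hqr⟩ := exists_between hx
  have hq : 0 < q := (norm_nonneg x).trans_lt hxq
  obtain ⟨K, -, hK⟩ := exists_natCast_mul_pow_pred_le hq hqr
  have hxball : x ∈ ball (0 : ℂ) q := mem_ball_zero_iff.2 hxq
  rw [← tsum_coeff_mul_deriv_pow]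
  refine hasDerivAt_tsum_of_isPreconnected (s.summable_norm_coeff_mul_pow.mul_left K) isOpen_ball
    (convex_ball (0 : ℂ) q).isPreconnected
    (fun p z _ => ((hasDerivAt_pow p.1 z).const_mul _).mul_const _) (fun p z hz => ?_) hxball
    (summable_mul_pow_mul_pow s.summable_norm_coeff_mul_pow hx.le hy.le) hxball
  have := rho_pos
  calc ‖s.coeff p.1 p.2 * (p.1 * z ^ (p.1 - 1)) * y ^ p.2‖
      = ‖s.coeff p.1 p.2‖ * ((p.1 : ℝ) * ‖z‖ ^ (p.1 - 1)) * ‖y‖ ^ p.2 := by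
        simp only [norm_mul, norm_pow, Complex.norm_natCast]
    _ ≤ ‖s.coeff p.1 p.2‖ * ((p.1 : ℝ) * q ^ (p.1 - 1)) * rho ^ p.2 := by
        have hzq : ‖z‖ ≤ q := (mem_ball_zero_iff.1 hz).le
        gcongr
    _ ≤ ‖s.coeff p.1 p.2‖ * (K * rho ^ p.1) * rho ^ p.2 := by
        gcongr ‖s.coeff p.1 p.2‖ * ?_ * rho ^ p.2
        exact hK p.1
    _ = K * (‖s.coeff p.1 p.2‖ * rho ^ (p.1 + p.2)) := by rw [pow_add]; ring

theorem tsum_derivCoeff_swap (s : FunSpace) (x y : ℂ) :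
    ∑' p : ℕ × ℕ, s.derivCoeff p.swap * x ^ p.1 * y ^ p.2 =
      ∑' p : ℕ × ℕ, s.derivCoeff p * y ^ p.1 * x ^ p.2 := by
  rw [← (Equiv.prodComm ℕ ℕ).tsum_eq]
  exact tsum_congr fun p => mul_right_comm _ _ _

theorem mem_symSubmodule_of_deriv_eq {s : FunSpace}
    (h : ∀ x y : ℂ, ‖x‖ < rho → ‖y‖ < rho →
      deriv (fun x' => s.eval x' y) x = deriv (fun x' => s.eval x' x) y) :
    s ∈ symSubmodule := by
  intro i j
  have hq : 0 < rho / 2 := half_pos rho_pos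
  have hqr : rho / 2 < rho := half_lt_self rho_pos
  have hsum := s.summable_derivCoeff hq hqr
  have hsum_swap : Summable fun p : ℕ × ℕ => ‖s.derivCoeff p.swap‖ * (rho / 2) ^ (p.1 + p.2) :=
    ((Equiv.prodComm ℕ ℕ).summable_iff.2 hsum).congr fun p => by simp [add_comm]
  have hsum_sub : Summable fun p : ℕ × ℕ =>
      ‖s.derivCoeff p - s.derivCoeff p.swap‖ * (rho / 2) ^ (p.1 + p.2) := by
    refine Summable.of_nonneg_of_le (fun p => by positivity) (fun p => ?_) (hsum.add hsum_swap)
    rw [← add_mul]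
    gcongr
    exact norm_sub_le _ _
  refine sub_eq_zero.1 <| coeff_eq_zero_of_tsum_mul_pow_mul_pow_eq_zero
    (c := fun p => s.derivCoeff p - s.derivCoeff p.swap) hq hsum_sub (fun x y hx hy => ?_) i j
  have hderiv := h x y (hx.trans hqr) (hy.trans hqr)
  rw [(s.hasDerivAt_eval_fst (hx.trans hqr) (hy.trans hqr)).deriv,
    (s.hasDerivAt_eval_fst (hy.trans hqr) (hx.trans hqr)).deriv, ← tsum_derivCoeff_swap s x y,
    ← sub_eq_zero] at hderiv
  simp_rw [sub_mul]
  rwa [(summable_mul_pow_mul_pow hsum hx.le hy.le).tsum_sub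
    (summable_mul_pow_mul_pow (c := fun p => s.derivCoeff p.swap) hsum_swap hx.le hy.le)]

end FunSpace

theorem deriv_ev_fst_symm (s : SymSpace) {x y : ℂ} (hx : ‖x‖ < rho) (hy : ‖y‖ < rho) :
    deriv (fun x' => ev s x' y) x = deriv (fun x' => ev s x' x) y := by
  have hxy : deriv (fun x' => ev s x' y) x = _ := (s.1.hasDerivAt_eval_fst hx hy).deriv
  have hyx : deriv (fun x' => ev s x' x) y = _ := (s.1.hasDerivAt_eval_fst hy hx).deriv
  rw [hxy, hyx, ← FunSpace.tsum_derivCoeff_swap _ x y]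
  exact tsum_congr fun p => congrArg (· * x ^ p.1 * y ^ p.2) (s.2 p.1 p.2)

theorem isClosed_symSubmodule : IsClosed (symSubmodule : Set FunSpace) :=
  (completeSpace_coe_iff_isComplete.1 (inferInstance : CompleteSpace SymSpace)).isClosed

theorem differentiableAt_of_differentiableAt_coe {𝕜 E F : Type*} [NontriviallyNormedField 𝕜]
    [NormedAddCommGroup E] [NormedSpace 𝕜 E] [NormedAddCommGroup F] [NormedSpace 𝕜 F]
    {S : Submodule 𝕜 F} (hS : IsClosed (S : Set F)) {f : E → S} {a : E}
    (hf : DifferentiableAt 𝕜 (fun e => (f e : F)) a) : DifferentiableAt 𝕜 f a := by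
  obtain ⟨D, hD⟩ := hf
  have hmem (v : E) : D v ∈ S := by
    have hline : HasLineDerivAt 𝕜 (fun e => (f e : F)) (D v) a v := hD.hasLineDerivAt v
    exact hS.mem_of_tendsto (hasDerivAt_iff_tendsto_slope.1 hline) <| Eventually.of_forall
      fun t => S.smul_mem _ (S.sub_mem (f _).2 (f _).2)
  refine ⟨D.codRestrict S hmem, ?_⟩
  rw [hasFDerivAt_iff_isLittleO] at hD ⊢
  exact Asymptotics.isLittleO_norm_left.1 (Asymptotics.isLittleO_norm_left.2 hD :)

/-! ### Partial derivatives and the implicit function theorem -/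

section PartialDerivatives

variable {𝕜 E F : Type*} [NormedAddCommGroup E] [NormedAddCommGroup F]

theorem fderiv_prod_apply_eq_add_deriv [NontriviallyNormedField 𝕜] [NormedSpace 𝕜 E]
    [NormedSpace 𝕜 F] {f : E × (𝕜 × 𝕜) → F} {e : E} {x y : 𝕜}
    (hf : DifferentiableAt 𝕜 f (e, (x, y))) (v : E) (h k : 𝕜) :
    fderiv 𝕜 f (e, (x, y)) (v, (h, k)) = fderiv 𝕜 f (e, (x, y)) (v, 0) +
      h • deriv (fun x' => f (e, (x', y))) x + k • deriv (fun y' => f (e, (x, y'))) y := by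
  have hfst : HasDerivAt (fun x' => (e, (x', y))) (0, (1, 0)) x :=
    (hasDerivAt_const x e).prodMk ((hasDerivAt_id x).prodMk (hasDerivAt_const x y))
  have hsnd : HasDerivAt (fun y' => (e, (x, y'))) (0, (0, 1)) y :=
    (hasDerivAt_const y e).prodMk ((hasDerivAt_const y x).prodMk (hasDerivAt_id y))
  have hD := hf.hasFDerivAt
  have hsplit : ((v, (h, k)) : E × (𝕜 × 𝕜)) = (v, 0) + h • (0, (1, 0)) + k • (0, (0, 1)) := by
    ext <;> simp
  rw [show deriv (fun x' => f (e, (x', y))) x = _ from (hD.comp_hasDerivAt x hfst).deriv,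
    show deriv (fun y' => f (e, (x, y'))) y = _ from (hD.comp_hasDerivAt y hsnd).deriv,
    hsplit, map_add, map_add, map_smul, map_smul]

theorem exists_contDiffAt_implicit [RCLike 𝕜] [NormedSpace 𝕜 E] [CompleteSpace E] {M : E × 𝕜 → 𝕜}
    {n : WithTop ℕ∞} (hn : n ≠ 0) {e : E} {z : 𝕜} (hM : ContDiffAt 𝕜 n M (e, z))
    (hd : deriv (fun w => M (e, w)) z ≠ 0) :
    ∃ f : E → 𝕜, ContDiffAt 𝕜 n f e ∧ ∀ᶠ v in 𝓝 (e, z), M v = M (e, z) ↔ f v.1 = v.2 := by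
  have hsnd : HasDerivAt (fun w : 𝕜 => (e, w)) (0, 1) z :=
    (hasDerivAt_const z e).prodMk (hasDerivAt_id z)
  have hderiv : deriv (fun w => M (e, w)) z = fderiv 𝕜 M (e, z) (0, 1) :=
    ((hM.differentiableAt hn).hasFDerivAt.comp_hasDerivAt z hsnd).deriv
  have hinv : (fderiv 𝕜 M (e, z) ∘L .inr 𝕜 E 𝕜).IsInvertible := by
    refine ⟨ContinuousLinearEquiv.unitsEquivAut 𝕜 (Units.mk0 _ (hderiv ▸ hd)), ?_⟩
    ext
    simp
  exact ⟨hM.implicitFunction hn hinv, hM.contDiffAt_implicitFunction hn hinv,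
    hM.eventually_apply_eq_iff_implicitFunction hn hinv⟩

end PartialDerivatives

/-! ### Evaluation on the symmetric space -/

theorem norm_one_lt_rho : ‖(1 : ℂ)‖ < rho := by norm_num [rho]

theorem norm_zero_lt_rho : ‖(0 : ℂ)‖ < rho := by norm_num [rho]

theorem eventually_norm_lt {E : Type*} [SeminormedAddCommGroup E] {x : E} {r : ℝ} (hx : ‖x‖ < r) :
    ∀ᶠ x' in 𝓝 x, ‖x'‖ < r :=
  continuous_norm.continuousAt.eventually_lt continuousAt_const hx

theorem ev_ofFun {f : ℂ → ℂ → ℂ} {g : SymSpace}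
    (hg : ∀ p : ℂ × ℂ, ‖p‖ < rho → ev g p.1 p.2 = f p.1 p.2) {p : ℂ × ℂ} (hp : ‖p‖ < rho) :
    ev (ofFun f) p.1 p.2 = f p.1 p.2 := by
  have hex : ∃ g : SymSpace, ∀ x y : ℂ, (x, y) ∈ bidisk rho → ev g x y = f x y :=
    ⟨g, fun x y hxy => hg (x, y) (mem_bidisk_iff.1 hxy)⟩
  rw [ofFun, dif_pos hex]
  exact Classical.choose_spec hex p.1 p.2 (mem_bidisk_iff.2 hp)

theorem ev_ofFun_of_ne_zero {f : ℂ → ℂ → ℂ} (hf : ofFun f ≠ 0) {p : ℂ × ℂ} (hp : ‖p‖ < rho) :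
    ev (ofFun f) p.1 p.2 = f p.1 p.2 := by
  obtain ⟨g, hg⟩ : ∃ g : SymSpace, ∀ x y : ℂ, (x, y) ∈ bidisk rho → ev g x y = f x y :=
    not_not.1 fun hex => hf (dif_neg hex)
  exact ev_ofFun (fun p hp => hg p.1 p.2 (mem_bidisk_iff.2 hp)) hp

/-- Evaluation at `p` as a continuous linear functional on `𝒜_s(ρ)`, meaningful for `‖p‖ < ρ`. -/
noncomputable def evL (p : ℂ × ℂ) : SymSpace →L[ℂ] ℂ :=
  (FunSpace.evalL p).comp symSubmodule.subtypeL

theorem evL_apply {p : ℂ × ℂ} (hp : ‖p‖ < rho) (s : SymSpace) : evL p s = ev s p.1 p.2 :=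
  FunSpace.evalL_apply hp s.1

theorem contDiffAt_evL {n : WithTop ℕ∞} {p : ℂ × ℂ} (hp : ‖p‖ < rho) : ContDiffAt ℂ n evL p :=
  (FunSpace.contDiffAt_evalL hp).clm_comp contDiffAt_const

theorem ev_zero (x y : ℂ) : ev 0 x y = 0 := by simp [ev, FunSpace.eval, FunSpace.coeff]

theorem ext_ev {s t : SymSpace} (h : ∀ p : ℂ × ℂ, ‖p‖ < rho → ev s p.1 p.2 = ev t p.1 p.2) :
    s = t :=
  Subtype.ext (FunSpace.ext_eval h)

/-- The value `s(x, y)` as a function of the triple `(s, (x, y))`. -/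
noncomputable def evUncurried (q : SymSpace × (ℂ × ℂ)) : ℂ := ev q.1 q.2.1 q.2.2

theorem contDiffAt_evUncurried {n : WithTop ℕ∞} {q : SymSpace × (ℂ × ℂ)} (hq : ‖q.2‖ < rho) :
    ContDiffAt ℂ n evUncurried q := by
  have hL : ContDiffAt ℂ n (fun q : SymSpace × (ℂ × ℂ) => evL q.2 q.1) q :=
    ((contDiffAt_evL hq).comp q contDiffAt_snd).clm_apply contDiffAt_fst
  refine hL.congr_of_eventuallyEq ?_
  filter_upwards [continuousAt_snd.eventually (eventually_norm_lt hq)] with q' hq'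
  exact (evL_apply hq' _).symm

/-- The partial derivative `∂₁s(x, y)`. -/
noncomputable def evD₁ (s : SymSpace) (x y : ℂ) : ℂ := deriv (fun x' => ev s x' y) x

/-- The partial derivative `∂₂s(x, y)`. -/
noncomputable def evD₂ (s : SymSpace) (x y : ℂ) : ℂ := deriv (fun y' => ev s x y') y

theorem evD₁_symm (s : SymSpace) {x y : ℂ} (hx : ‖x‖ < rho) (hy : ‖y‖ < rho) :
    evD₁ s x y = evD₁ s y x :=
  deriv_ev_fst_symm s hx hy

theorem differentiableAt_evUncurried (s : SymSpace) {x y : ℂ} (hx : ‖x‖ < rho) (hy : ‖y‖ < rho) :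
    DifferentiableAt ℂ evUncurried (s, (x, y)) :=
  (contDiffAt_evUncurried (n := 1) (max_lt hx hy)).differentiableAt one_ne_zero

theorem differentiableAt_ev_fst (s : SymSpace) {x y : ℂ} (hx : ‖x‖ < rho) (hy : ‖y‖ < rho) :
    DifferentiableAt ℂ (fun x' => ev s x' y) x :=
  (differentiableAt_evUncurried s hx hy).fun_comp' (f := fun x' => (s, (x', y))) x (by fun_prop)

theorem differentiableAt_ev_snd (s : SymSpace) {x y : ℂ} (hx : ‖x‖ < rho) (hy : ‖y‖ < rho) :
    DifferentiableAt ℂ (fun y' => ev s x y') y :=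
  (differentiableAt_evUncurried s hx hy).fun_comp' (f := fun y' => (s, (x, y'))) y (by fun_prop)

theorem fderiv_evUncurried_apply (s : SymSpace) {x y : ℂ} (hx : ‖x‖ < rho) (hy : ‖y‖ < rho)
    (v : SymSpace) (h k : ℂ) :
    fderiv ℂ evUncurried (s, (x, y)) (v, (h, k)) =
      ev v x y + h * evD₁ s x y + k * evD₂ s x y := by
  have hdiff := differentiableAt_evUncurried s hx hy
  have hlinear : (fderiv ℂ evUncurried (s, (x, y))).comp (.inl ℂ _ _) = evL (x, y) :=
    HasFDerivAt.unique (f := fun s' => ev s' x y)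
      (HasFDerivAt.comp (g := evUncurried) (f := fun s' => (s', (x, y))) s hdiff.hasFDerivAt
        (hasFDerivAt_prodMk_left s (x, y)))
      ((evL (x, y)).hasFDerivAt.congr_of_eventuallyEq
        (.of_forall fun s' => (evL_apply (p := (x, y)) (max_lt hx hy) s').symm))
  have hv : fderiv ℂ evUncurried (s, (x, y)) (v, 0) = ev v x y :=
    (DFunLike.congr_fun hlinear v).trans (evL_apply (max_lt hx hy) v)
  rw [fderiv_prod_apply_eq_add_deriv hdiff, hv]
  rfl

theorem hasFDerivAt_ev_comp {E : Type*} [NormedAddCommGroup E] [NormedSpace ℂ E] {e : E}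
    {s : E → SymSpace} {x y : E → ℂ} {s' : E →L[ℂ] SymSpace} {x' y' : E →L[ℂ] ℂ}
    (hs : HasFDerivAt s s' e) (hx : HasFDerivAt x x' e) (hy : HasFDerivAt y y' e)
    (hxe : ‖x e‖ < rho) (hye : ‖y e‖ < rho) :
    HasFDerivAt (fun e => ev (s e) (x e) (y e)) ((evL (x e, y e)).comp s' +
      evD₁ (s e) (x e) (y e) • x' + evD₂ (s e) (x e) (y e) • y') e := by
  refine ((differentiableAt_evUncurried (s e) hxe hye).hasFDerivAt.comp e
    (f := fun e => (s e, (x e, y e))) (hs.prodMk (hx.prodMk hy))).congr_fderiv ?_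
  ext v
  simp only [ContinuousLinearMap.comp_apply, ContinuousLinearMap.prod_apply, add_apply, smul_apply,
    smul_eq_mul, evL_apply (max_lt hxe hye : ‖(x e, y e)‖ < rho),
    fderiv_evUncurried_apply _ hxe hye]
  ring

/-- The partial derivative `s ↦ ∂₁s(x, y)` as a continuous linear functional on `𝒜_s(ρ)`. -/
noncomputable def evD₁L (x y : ℂ) : SymSpace →L[ℂ] ℂ := deriv (fun x' => evL (x', y)) x

theorem evD₁L_apply {x y : ℂ} (hx : ‖x‖ < rho) (hy : ‖y‖ < rho) (s : SymSpace) :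
    evD₁L x y s = evD₁ s x y := by
  have hdiff : DifferentiableAt ℂ (fun x' => evL (x', y)) x :=
    ((contDiffAt_evL (n := 1) (max_lt hx hy)).differentiableAt one_ne_zero).fun_comp'
      (f := fun x' => (x', y)) x (by fun_prop)
  have hderivL : HasDerivAt (fun x' => evL (x', y)) (evD₁L x y) x :=
    DifferentiableAt.hasDerivAt (𝕜 := ℂ) (F := SymSpace →L[ℂ] ℂ) hdiff
  have hderiv : HasDerivAt (fun x' => evL (x', y) s) (evD₁L x y s) x :=
    HasFDerivAt.comp_hasDerivAt (f := fun x' => evL (x', y)) x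
      (ContinuousLinearMap.apply ℂ ℂ s).hasFDerivAt hderivL
  rw [evD₁, ← hderiv.deriv]
  refine EventuallyEq.deriv_eq ?_
  filter_upwards [eventually_norm_lt hx] with x' hx'
  exact evL_apply (max_lt hx' hy) s

theorem ev_sub (s t : SymSpace) {x y : ℂ} (hx : ‖x‖ < rho) (hy : ‖y‖ < rho) :
    ev (s - t) x y = ev s x y - ev t x y := by
  have hp : ‖(x, y)‖ < rho := max_lt hx hy
  simpa only [evL_apply hp] using map_sub (evL (x, y)) s t

theorem evD₁_sub (s t : SymSpace) {x y : ℂ} (hx : ‖x‖ < rho) (hy : ‖y‖ < rho) :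
    evD₁ (s - t) x y = evD₁ s x y - evD₁ t x y := by
  simpa only [evD₁L_apply hx hy] using map_sub (evD₁L x y) s t

theorem differentiableAt_evD₁_fst (s : SymSpace) {x y : ℂ} (hx : ‖x‖ < rho) (hy : ‖y‖ < rho) :
    DifferentiableAt ℂ (fun x' => evD₁ s x' y) x := by
  have hdiff : DifferentiableOn ℂ (fun x' => ev s x' y) (ball 0 rho) := fun x' hx' =>
    (differentiableAt_ev_fst s (mem_ball_zero_iff.1 hx') hy).differentiableWithinAt
  exact (hdiff.deriv isOpen_ball).differentiableAt
    (isOpen_ball.mem_nhds (mem_ball_zero_iff.2 hx))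

theorem ev_psiEKW {s : SymSpace} (hψ : psiEKW s ≠ 0) {x y : ℂ} (hx : ‖x‖ < rho) (hy : ‖y‖ < rho) :
    ev (psiEKW s) x y = evD₁ s x y * x ^ 2 + evD₂ s x y * y ^ 2 + 2 * ev s x y * y - ev s x y -
      (evD₁ s x y * x + evD₂ s x y * y) :=
  ev_ofFun_of_ne_zero hψ (p := (x, y)) (max_lt hx hy)

/-! ### The midpoint branch and the prerenormalization -/

/-- The prerenormalization `𝒫_EKW[s](x, y)` as a function of the triple `(s, (x, y))`. -/
noncomputable def preUncurried (Z : SymSpace → ℂ × ℂ → ℂ) (q : SymSpace × (ℂ × ℂ)) : ℂ :=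
  preEKW Z q.1 q.2.1 q.2.2

/-- The partial derivative `∂₁𝒫_EKW[s](x, y)`. -/
noncomputable def preD₁ (Z : SymSpace → ℂ × ℂ → ℂ) (s : SymSpace) (x y : ℂ) : ℂ :=
  deriv (fun x' => preEKW Z s x' y) x

/-- The partial derivative `∂₂𝒫_EKW[s](x, y)`. -/
noncomputable def preD₂ (Z : SymSpace → ℂ × ℂ → ℂ) (s : SymSpace) (x y : ℂ) : ℂ :=
  deriv (fun y' => preEKW Z s x y') y

theorem norm_swap {E F : Type*} [SeminormedAddCommGroup E] [SeminormedAddCommGroup F]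
    (p : E × F) : ‖p.swap‖ = ‖p‖ :=
  max_comm _ _

namespace IsMidpointBranch

variable {U : Set SymSpace} {r : ℝ} {Z : SymSpace → ℂ × ℂ → ℂ} {s : SymSpace} {p : ℂ × ℂ}

theorem norm_fst_lt_rho (hZ : IsMidpointBranch U r Z) (hp : ‖p‖ < r) : ‖p.1‖ < rho :=
  (norm_fst_le p).trans_lt (hp.trans_le hZ.r_le)

theorem norm_snd_lt_rho (hZ : IsMidpointBranch U r Z) (hp : ‖p‖ < r) : ‖p.2‖ < rho :=
  (norm_snd_le p).trans_lt (hp.trans_le hZ.r_le)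

theorem norm_apply_lt_rho (hZ : IsMidpointBranch U r Z) (hs : s ∈ U) (hp : ‖p‖ < r) :
    ‖Z s p‖ < rho :=
  hZ.norm_lt s hs p (mem_bidisk_iff.2 hp)

theorem ev_add_ev_eq_zero (hZ : IsMidpointBranch U r Z) (hs : s ∈ U) (hp : ‖p‖ < r) :
    ev s p.1 (Z s p) + ev s p.2 (Z s p) = 0 :=
  hZ.midpoint s hs p (mem_bidisk_iff.2 hp)

theorem eventually_mem_and_norm_lt (hU : IsOpen U) (hs : s ∈ U) (hp : ‖p‖ < r) :
    ∀ᶠ q in 𝓝 (s, p), q.1 ∈ U ∧ ‖q.2‖ < r :=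
  (continuousAt_fst.eventually (hU.mem_nhds hs)).and
    (continuousAt_snd.eventually (eventually_norm_lt hp))

theorem evD₂_add_evD₂_ne_zero (hZ : IsMidpointBranch U r Z) (hs : s ∈ U) (hp : ‖p‖ < r) :
    evD₂ s p.1 (Z s p) + evD₂ s p.2 (Z s p) ≠ 0 := by
  have hz := hZ.norm_apply_lt_rho hs hp
  have hsimple := hZ.simple s hs p (mem_bidisk_iff.2 hp)
  rwa [deriv_fun_add (differentiableAt_ev_snd s (hZ.norm_fst_lt_rho hp) hz)
    (differentiableAt_ev_snd s (hZ.norm_snd_lt_rho hp) hz)] at hsimple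

theorem exists_contDiffAt_local_solution (hZ : IsMidpointBranch U r Z) (hs : s ∈ U)
    (hp : ‖p‖ < r) : ∃ f : SymSpace × (ℂ × ℂ) → ℂ, ContDiffAt ℂ ω f (s, p) ∧
      ∀ᶠ v in 𝓝 ((s, p), Z s p),
        ev v.1.1 v.1.2.1 v.2 + ev v.1.1 v.1.2.2 v.2 = 0 ↔ f v.1 = v.2 := by
  let M : (SymSpace × (ℂ × ℂ)) × ℂ → ℂ := fun v => ev v.1.1 v.1.2.1 v.2 + ev v.1.1 v.1.2.2 v.2
  have hz := hZ.norm_apply_lt_rho hs hp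
  have hx := hZ.norm_fst_lt_rho hp
  have hy := hZ.norm_snd_lt_rho hp
  have hM : ContDiffAt ℂ ω M ((s, p), Z s p) := by
    refine ContDiffAt.add ?_ ?_
    · exact ContDiffAt.comp (g := evUncurried)
        (f := fun v : (SymSpace × (ℂ × ℂ)) × ℂ => (v.1.1, (v.1.2.1, v.2))) _
        (contDiffAt_evUncurried (max_lt hx hz)) (by fun_prop)
    · exact ContDiffAt.comp (g := evUncurried)
        (f := fun v : (SymSpace × (ℂ × ℂ)) × ℂ => (v.1.1, (v.1.2.2, v.2))) _
        (contDiffAt_evUncurried (max_lt hy hz)) (by fun_prop)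
  obtain ⟨f, hf, hsol⟩ :=
    exists_contDiffAt_implicit (by simp) hM (hZ.simple s hs p (mem_bidisk_iff.2 hp))
  have hroot : M ((s, p), Z s p) = 0 := hZ.ev_add_ev_eq_zero hs hp
  exact ⟨f, hf, by simpa only [hroot] using hsol⟩

theorem continuousAt (hZ : IsMidpointBranch U r Z) (hU : IsOpen U) (hs : s ∈ U) (hp : ‖p‖ < r) :
    ContinuousAt (Function.uncurry Z) (s, p) :=
  hZ.cont.continuousAt ((hU.prod (isOpen_bidisk r)).mem_nhds ⟨hs, mem_bidisk_iff.2 hp⟩)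

theorem contDiffAt (hZ : IsMidpointBranch U r Z) (hU : IsOpen U) (hs : s ∈ U) (hp : ‖p‖ < r) :
    ContDiffAt ℂ ω (Function.uncurry Z) (s, p) := by
  obtain ⟨f, hf, hsol⟩ := hZ.exists_contDiffAt_local_solution hs hp
  refine hf.congr_of_eventuallyEq ?_
  filter_upwards [(continuousAt_id.prodMk (hZ.continuousAt hU hs hp)).eventually hsol,
    eventually_mem_and_norm_lt hU hs hp] with q hq hmem
  exact (hq.1 (hZ.ev_add_ev_eq_zero hmem.1 hmem.2)).symm

theorem hasFDerivAt (hZ : IsMidpointBranch U r Z) (hU : IsOpen U) (hs : s ∈ U) (hp : ‖p‖ < r) :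
    HasFDerivAt (Function.uncurry Z) (fderiv ℂ (Function.uncurry Z) (s, p)) (s, p) :=
  ((hZ.contDiffAt hU hs hp).differentiableAt (by simp)).hasFDerivAt

theorem analyticOnNhd (hZ : IsMidpointBranch U r Z) (hU : IsOpen U) (hs : s ∈ U) :
    AnalyticOnNhd ℂ (Z s) (ball 0 r) := fun p hp =>
  ((hZ.contDiffAt hU hs (mem_ball_zero_iff.1 hp)).comp p
    (f := fun p => (s, p)) (by fun_prop)).analyticAt

theorem analyticOnNhd_swap (hZ : IsMidpointBranch U r Z) (hU : IsOpen U) (hs : s ∈ U) :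
    AnalyticOnNhd ℂ (fun p : ℂ × ℂ => Z s p.swap) (ball 0 r) := fun p hp =>
  (hZ.analyticOnNhd hU hs p.swap (by simpa [norm_swap] using hp)).comp_of_eq
    (analyticAt_snd.prod analyticAt_fst) rfl

theorem eventuallyEq_swap (hZ : IsMidpointBranch U r Z) (hU : IsOpen U) (hs : s ∈ U) :
    (fun p : ℂ × ℂ => Z s p.swap) =ᶠ[𝓝 0] Z s := by
  have hzero : (0 : ℂ × ℂ) ∈ ball 0 r := mem_ball_self hZ.r_pos
  obtain ⟨f, -, hsol⟩ := hZ.exists_contDiffAt_local_solution hs (mem_ball_zero_iff.1 hzero)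
  have hpair : ContinuousAt (fun p : ℂ × ℂ => (s, p)) 0 := by fun_prop
  filter_upwards [ball_mem_nhds 0 hZ.r_pos,
    (hpair.prodMk (hZ.analyticOnNhd hU hs 0 hzero).continuousAt).eventually hsol,
    (hpair.prodMk (hZ.analyticOnNhd_swap hU hs 0 hzero).continuousAt).eventually hsol]
    with p hp hsol_p hsol_swap
  have hroot := hZ.ev_add_ev_eq_zero hs (mem_ball_zero_iff.1 hp)
  have hroot_swap := hZ.ev_add_ev_eq_zero hs (p := p.swap) (by simpa [norm_swap] using hp)
  exact (hsol_swap.1 ((add_comm _ _).trans hroot_swap)).symm.trans (hsol_p.1 hroot)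

theorem apply_swap (hZ : IsMidpointBranch U r Z) (hU : IsOpen U) (hs : s ∈ U) (hp : ‖p‖ < r) :
    Z s p.swap = Z s p :=
  (hZ.analyticOnNhd_swap hU hs).eqOn_of_preconnected_of_eventuallyEq (hZ.analyticOnNhd hU hs)
    (convex_ball _ _).isPreconnected (mem_ball_self hZ.r_pos) (hZ.eventuallyEq_swap hU hs)
    (mem_ball_zero_iff.2 hp)

theorem fderiv_midpoint_eq_zero (hZ : IsMidpointBranch U r Z) (hU : IsOpen U) (hs : s ∈ U)
    (hp : ‖p‖ < r) (v : SymSpace) (h k : ℂ) :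
    ev v p.1 (Z s p) + ev v p.2 (Z s p) + h * evD₁ s p.1 (Z s p) + k * evD₁ s p.2 (Z s p) +
      (evD₂ s p.1 (Z s p) + evD₂ s p.2 (Z s p)) *
        fderiv ℂ (Function.uncurry Z) (s, p) (v, (h, k)) = 0 := by
  have hz := hZ.norm_apply_lt_rho hs hp
  have hx := hZ.norm_fst_lt_rho hp
  have hy := hZ.norm_snd_lt_rho hp
  have hD := hZ.hasFDerivAt hU hs hp
  have hfst := hasFDerivAt_ev_comp hasFDerivAt_fst (hasFDerivAt_fst.comp (s, p) hasFDerivAt_snd)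
    hD hx hz
  have hsnd := hasFDerivAt_ev_comp hasFDerivAt_fst (hasFDerivAt_snd.comp (s, p) hasFDerivAt_snd)
    hD hy hz
  have hconst := (hfst.add hsnd).congr_of_eventuallyEq (f₁ := fun _ => (0 : ℂ)) <| by
    filter_upwards [eventually_mem_and_norm_lt hU hs hp] with q hq
    exact (hZ.ev_add_ev_eq_zero hq.1 hq.2).symm
  have hzero := DFunLike.congr_fun (hconst.unique (hasFDerivAt_const (0 : ℂ) (s, p))) (v, (h, k))
  simp only [add_apply, smul_apply, smul_eq_mul, ContinuousLinearMap.comp_apply,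
    ContinuousLinearMap.coe_fst', ContinuousLinearMap.coe_snd', Function.comp,
    Function.uncurry_apply_pair, zero_apply, evL_apply (max_lt hx hz : ‖(p.1, Z s p)‖ < rho),
    evL_apply (max_lt hy hz : ‖(p.2, Z s p)‖ < rho)] at hzero
  linear_combination hzero

theorem contDiffAt_preUncurried (hZ : IsMidpointBranch U r Z) (hU : IsOpen U) (hs : s ∈ U)
    (hp : ‖p‖ < r) : ContDiffAt ℂ ω (preUncurried Z) (s, p) :=
  have hy := hZ.norm_snd_lt_rho hp
  ContDiffAt.comp (g := evUncurried)
    (f := fun q : SymSpace × (ℂ × ℂ) => (q.1, (Function.uncurry Z q, q.2.2))) (s, p)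
    (contDiffAt_evUncurried (max_lt (hZ.norm_apply_lt_rho hs hp) hy))
    (contDiffAt_fst.prodMk ((hZ.contDiffAt hU hs hp).prodMk (by fun_prop)))

theorem differentiableAt_preUncurried (hZ : IsMidpointBranch U r Z) (hU : IsOpen U) (hs : s ∈ U)
    (hp : ‖p‖ < r) : DifferentiableAt ℂ (preUncurried Z) (s, p) :=
  (hZ.contDiffAt_preUncurried hU hs hp).differentiableAt (by simp)

theorem fderiv_preUncurried_apply (hZ : IsMidpointBranch U r Z) (hU : IsOpen U) (hs : s ∈ U)
    (hp : ‖p‖ < r) (v : SymSpace) (h k : ℂ) :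
    fderiv ℂ (preUncurried Z) (s, p) (v, (h, k)) = ev v (Z s p) p.2 +
      fderiv ℂ (Function.uncurry Z) (s, p) (v, (h, k)) * evD₁ s (Z s p) p.2 +
        k * evD₂ s (Z s p) p.2 := by
  have hz := hZ.norm_apply_lt_rho hs hp
  have hy := hZ.norm_snd_lt_rho hp
  have hchain : fderiv ℂ (preUncurried Z) (s, p) = _ :=
    (hasFDerivAt_ev_comp hasFDerivAt_fst (hZ.hasFDerivAt hU hs hp)
      (hasFDerivAt_snd.comp (s, p) hasFDerivAt_snd) hz hy).fderiv
  rw [hchain]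
  simp only [add_apply, smul_apply, smul_eq_mul, ContinuousLinearMap.comp_apply,
    ContinuousLinearMap.coe_fst', ContinuousLinearMap.coe_snd', Function.comp,
    Function.uncurry_apply_pair, evL_apply (max_lt hz hy : ‖(Z s p, p.2)‖ < rho)]
  ring

variable {x y : ℂ}

theorem fderiv_preUncurried_eq_add (hZ : IsMidpointBranch U r Z) (hU : IsOpen U) (hs : s ∈ U)
    (hx : ‖x‖ < r) (hy : ‖y‖ < r) (v : SymSpace) (h k : ℂ) :
    fderiv ℂ (preUncurried Z) (s, (x, y)) (v, (h, k)) =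
      fderiv ℂ (preUncurried Z) (s, (x, y)) (v, 0) + h * preD₁ Z s x y + k * preD₂ Z s x y :=
  fderiv_prod_apply_eq_add_deriv (hZ.differentiableAt_preUncurried hU hs (max_lt hx hy)) v h k

theorem fderiv_preUncurried_zero_apply (hZ : IsMidpointBranch U r Z) (hU : IsOpen U) (hs : s ∈ U)
    (hx : ‖x‖ < r) (hy : ‖y‖ < r) (h k : ℂ) :
    fderiv ℂ (preUncurried Z) (s, (x, y)) (0, (h, k)) =
      h * preD₁ Z s x y + k * preD₂ Z s x y := by
  rw [hZ.fderiv_preUncurried_eq_add hU hs hx hy, ← Prod.zero_eq_mk, map_zero, zero_add]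

theorem preD₁_eq_fderiv (hZ : IsMidpointBranch U r Z) (hU : IsOpen U) (hs : s ∈ U)
    (hx : ‖x‖ < r) (hy : ‖y‖ < r) :
    preD₁ Z s x y = fderiv ℂ (preUncurried Z) (s, (x, y)) (0, (1, 0)) := by
  rw [hZ.fderiv_preUncurried_zero_apply hU hs hx hy, one_mul, zero_mul, add_zero]

theorem differentiableAt_preD₁ (hZ : IsMidpointBranch U r Z) (hU : IsOpen U) (hs : s ∈ U)
    (hx : ‖x‖ < r) (hy : ‖y‖ < r) :
    DifferentiableAt ℂ (fun q : SymSpace × (ℂ × ℂ) => preD₁ Z q.1 q.2.1 q.2.2) (s, (x, y)) := by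
  have hfderiv : DifferentiableAt ℂ (fderiv ℂ (preUncurried Z)) (s, (x, y)) :=
    ((hZ.contDiffAt_preUncurried hU hs (max_lt hx hy)).fderiv_right (m := 1)
      (by simp)).differentiableAt one_ne_zero
  refine (hfderiv.clm_apply (differentiableAt_const (0, (1, 0)))).congr_of_eventuallyEq ?_
  filter_upwards [eventually_mem_and_norm_lt hU hs (max_lt hx hy)] with q hq
  exact hZ.preD₁_eq_fderiv hU hq.1 ((norm_fst_le _).trans_lt hq.2) ((norm_snd_le _).trans_lt hq.2)

theorem hasDerivAt_preEKW (hZ : IsMidpointBranch U r Z) (hU : IsOpen U) (hs : s ∈ U)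
    {x y : ℂ → ℂ} {a x' y' : ℂ} (hx : HasDerivAt x x' a) (hy : HasDerivAt y y' a)
    (hxa : ‖x a‖ < r) (hya : ‖y a‖ < r) :
    HasDerivAt (fun z => preEKW Z s (x z) (y z))
      (x' * preD₁ Z s (x a) (y a) + y' * preD₂ Z s (x a) (y a)) a := by
  rw [← hZ.fderiv_preUncurried_zero_apply hU hs hxa hya]
  exact HasFDerivAt.comp_hasDerivAt (f := fun z => (s, (x z, y z))) a
    (hZ.differentiableAt_preUncurried hU hs (max_lt hxa hya)).hasFDerivAt
    ((hasDerivAt_const a s).prodMk (hx.prodMk hy))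

theorem preD₁_symm (hZ : IsMidpointBranch U r Z) (hU : IsOpen U) (hs : s ∈ U)
    (hx : ‖x‖ < r) (hy : ‖y‖ < r) : preD₁ Z s x y = preD₁ Z s y x := by
  have hxy : ‖(x, y)‖ < r := max_lt hx hy
  have hyx : ‖(y, x)‖ < r := max_lt hy hx
  have hz := hZ.norm_apply_lt_rho hs hxy
  have hswap : Z s (y, x) = Z s (x, y) := hZ.apply_swap hU hs hxy
  have hmid := hZ.fderiv_midpoint_eq_zero hU hs hxy 0 1 0
  have hmid_swap := hZ.fderiv_midpoint_eq_zero hU hs hyx 0 1 0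
  have hne := hZ.evD₂_add_evD₂_ne_zero hs hxy
  rw [hZ.preD₁_eq_fderiv hU hs hx hy, hZ.preD₁_eq_fderiv hU hs hy hx,
    hZ.fderiv_preUncurried_apply hU hs hxy, hZ.fderiv_preUncurried_apply hU hs hyx]
  simp only [hswap, ev_zero, zero_add, add_zero, zero_mul, one_mul] at hmid hmid_swap hne ⊢
  rw [evD₁_symm s hz (hZ.norm_snd_lt_rho hxy), evD₁_symm s hz (hZ.norm_snd_lt_rho hyx)]
  apply mul_left_cancel₀ hne
  linear_combination evD₁ s y (Z s (x, y)) * hmid - evD₁ s x (Z s (x, y)) * hmid_swap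

/-- `ψ` generates a flow of coordinate changes with `(x, y) ↦ (x² - x, y² - y)` as vector field, and
midpoints are equivariant under coordinate changes: hence `Z` moves by the same vector field. -/
theorem fderiv_uncurry_psiEKW (hZ : IsMidpointBranch U r Z) (hU : IsOpen U) (hs : s ∈ U)
    (hψ : psiEKW s ≠ 0) (hp : ‖p‖ < r) :
    fderiv ℂ (Function.uncurry Z) (s, p) (psiEKW s, 0) =
      fderiv ℂ (Function.uncurry Z) (s, p) (0, (p.1 ^ 2 - p.1, p.2 ^ 2 - p.2)) -
        (Z s p ^ 2 - Z s p) := by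
  have hz := hZ.norm_apply_lt_rho hs hp
  have hroot := hZ.ev_add_ev_eq_zero hs hp
  have hmid_psi := hZ.fderiv_midpoint_eq_zero hU hs hp (psiEKW s) 0 0
  have hmid_flow := hZ.fderiv_midpoint_eq_zero hU hs hp 0 (p.1 ^ 2 - p.1) (p.2 ^ 2 - p.2)
  rw [ev_psiEKW hψ (hZ.norm_fst_lt_rho hp) hz, ev_psiEKW hψ (hZ.norm_snd_lt_rho hp) hz,
    ← Prod.zero_eq_mk] at hmid_psi
  simp only [ev_zero] at hmid_flow
  apply mul_left_cancel₀ (hZ.evD₂_add_evD₂_ne_zero hs hp)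
  linear_combination hmid_psi - hmid_flow - (2 * Z s p - 1) * hroot

theorem fderiv_preUncurried_psiEKW (hZ : IsMidpointBranch U r Z) (hU : IsOpen U) (hs : s ∈ U)
    (hψ : psiEKW s ≠ 0) (hx : ‖x‖ < r) (hy : ‖y‖ < r) :
    fderiv ℂ (preUncurried Z) (s, (x, y)) (psiEKW s, 0) =
      (x ^ 2 - x) * preD₁ Z s x y + (y ^ 2 - y) * preD₂ Z s x y +
        (2 * y - 1) * preEKW Z s x y := by
  have hxy : ‖(x, y)‖ < r := max_lt hx hy
  rw [← hZ.fderiv_preUncurried_zero_apply hU hs hx hy, Prod.zero_eq_mk,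
    hZ.fderiv_preUncurried_apply hU hs hxy, hZ.fderiv_preUncurried_apply hU hs hxy,
    ← Prod.zero_eq_mk, hZ.fderiv_uncurry_psiEKW hU hs hψ hxy, ev_zero,
    ev_psiEKW hψ (hZ.norm_apply_lt_rho hs hxy) (hZ.norm_snd_lt_rho hxy), preEKW]
  ring

end IsMidpointBranch

/-! ### Differentiability of the renormalization operators -/

/-- The rescaled prerenormalization `𝒫(λx, λy)` as a function of `((s, (t, λ)), (x, y))`, with `t`
and `λ` as free parameters. -/
noncomputable def preParam (Z : SymSpace → ℂ × ℂ → ℂ) (q : (SymSpace × (ℂ × ℂ)) × (ℂ × ℂ)) : ℂ :=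
  (1 + 2 * q.1.2.1 * (q.1.2.2 * q.2.2)) * preUncurried Z (q.1.1,
    (q.1.2.2 * q.2.1 + q.1.2.1 * (q.1.2.2 * q.2.1) ^ 2,
      q.1.2.2 * q.2.2 + q.1.2.1 * (q.1.2.2 * q.2.2) ^ 2))

theorem hasDerivAt_add_const_mul_sq {𝕜 : Type*} [NontriviallyNormedField 𝕜] {f : 𝕜 → 𝕜}
    {f' a : 𝕜} (hf : HasDerivAt f f' a) (c : 𝕜) :
    HasDerivAt (fun x => f x + c * f x ^ 2) (f' * (1 + 2 * c * f a)) a :=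
  (hf.add ((hf.pow 2).const_mul c)).congr_deriv (by push_cast; ring)

theorem IsMidpointBranch.hasDerivAt_pre_fst {U : Set SymSpace} {r : ℝ}
    {Z : SymSpace → ℂ × ℂ → ℂ} (hZ : IsMidpointBranch U r Z) (hU : IsOpen U) {s : SymSpace}
    (hs : s ∈ U) {t : SymSpace → ℂ} {x : ℂ → ℂ} {x' y a : ℂ} (hx : HasDerivAt x x' a)
    (hxa : ‖x a + t s * x a ^ 2‖ < r) (hy : ‖y + t s * y ^ 2‖ < r) :
    HasDerivAt (fun z => pre Z t s (x z) y) (x' * ((1 + 2 * t s * x a) * (1 + 2 * t s * y) *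
      preD₁ Z s (x a + t s * x a ^ 2) (y + t s * y ^ 2))) a :=
  ((hZ.hasDerivAt_preEKW hU hs (hasDerivAt_add_const_mul_sq hx (t s)) (hasDerivAt_const a _)
    hxa hy).const_mul (1 + 2 * t s * y)).congr_deriv (by ring)

namespace IsScaling

variable {U : Set SymSpace} {r : ℝ} {Z : SymSpace → ℂ × ℂ → ℂ} {t lam : SymSpace → ℂ}
  {s : SymSpace} {x y : ℂ}

theorem norm_add_lt (hR : IsScaling U r Z t lam) (hs : s ∈ U) :
    ‖lam s + t s * lam s ^ 2‖ < r := by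
  simpa only [mul_one] using hR.domain s hs 1 norm_one_lt_rho.le

theorem lam_ne_zero (hR : IsScaling U r Z t lam) (hs : s ∈ U) : lam s ≠ 0 :=
  left_ne_zero_of_mul (hR.mu_ne_zero s hs)

theorem mu_eq (hR : IsScaling U r Z t lam) (hZ : IsMidpointBranch U r Z) (hU : IsOpen U)
    (hs : s ∈ U) :
    mu Z t lam s =
      lam s * ((1 + 2 * t s * lam s) * preD₁ Z s (lam s + t s * lam s ^ 2) 0) := by
  have hderiv := hZ.hasDerivAt_pre_fst hU hs (t := t) (y := 0) (hasDerivAt_id (lam s))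
    (hR.norm_add_lt hs) (by simpa using hZ.r_pos)
  simp only [id_eq] at hderiv
  rw [mu, hderiv.deriv]
  ring_nf

theorem exists_differentiableAt_eval_eq_preParam (hR : IsScaling U r Z t lam)
    (hZ : IsMidpointBranch U r Z) (hU : IsOpen U) (hs : s ∈ U) :
    ∃ Φ : SymSpace × (ℂ × ℂ) → FunSpace, DifferentiableAt ℂ Φ (s, (t s, lam s)) ∧
      ∀ᶠ e in 𝓝 (s, (t s, lam s)), ∀ p : ℂ × ℂ, ‖p‖ < rho →
        (Φ e).eval p.1 p.2 = preParam Z (e, p) := by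
  let change : (SymSpace × (ℂ × ℂ)) × (ℂ × ℂ) → SymSpace × (ℂ × ℂ) := fun q => (q.1.1,
    (q.1.2.2 * q.2.1 + q.1.2.1 * (q.1.2.2 * q.2.1) ^ 2,
      q.1.2.2 * q.2.2 + q.1.2.1 * (q.1.2.2 * q.2.2) ^ 2))
  have hchange : ContDiff ℂ 1 change := by fun_prop
  have hpre : ContDiffOn ℂ 1 (preParam Z) (change ⁻¹' (U ×ˢ ball 0 r)) := fun q hq =>
    ContDiffAt.contDiffWithinAt <| ContDiffAt.mul (by fun_prop) <|
      ((hZ.contDiffAt_preUncurried hU hq.1 (mem_ball_zero_iff.1 hq.2)).of_le (by simp)).comp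
        (f := change) q hchange.contDiffAt
  refine FunSpace.exists_differentiableAt_eval_eq
    ((hU.prod isOpen_ball).preimage hchange.continuous) (fun p hp => ⟨hs, ?_⟩) hpre
  exact mem_ball_zero_iff.2 (max_lt (hR.domain s hs _ ((norm_fst_le p).trans hp))
    (hR.domain s hs _ ((norm_snd_le p).trans hp)))

theorem hasDerivAt_pre_lam_mul_fst (hR : IsScaling U r Z t lam) (hZ : IsMidpointBranch U r Z)
    (hU : IsOpen U) (hs : s ∈ U) (hx : ‖x‖ < rho) (hy : ‖y‖ < rho) :
    HasDerivAt (fun x' => pre Z t s (lam s * x') (lam s * y))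
      (lam s * ((1 + 2 * t s * (lam s * x)) * (1 + 2 * t s * (lam s * y)) *
        preD₁ Z s (lam s * x + t s * (lam s * x) ^ 2) (lam s * y + t s * (lam s * y) ^ 2))) x :=
  hZ.hasDerivAt_pre_fst hU hs (hasDerivAt_const_mul (lam s)) (hR.domain s hs x hx.le)
    (hR.domain s hs y hy.le)

theorem exists_ev_eq_pre (hR : IsScaling U r Z t lam) (hZ : IsMidpointBranch U r Z)
    (hU : IsOpen U) (hs : s ∈ U) :
    ∃ g : SymSpace, ∀ p : ℂ × ℂ, ‖p‖ < rho →
      ev g p.1 p.2 = pre Z t s (lam s * p.1) (lam s * p.2) := by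
  obtain ⟨Φ, -, hΦ⟩ := hR.exists_differentiableAt_eval_eq_preParam hZ hU hs
  have hev : ∀ p : ℂ × ℂ, ‖p‖ < rho → (Φ (s, (t s, lam s))).eval p.1 p.2 =
      pre Z t s (lam s * p.1) (lam s * p.2) := hΦ.self_of_nhds
  have hderiv (x y : ℂ) (hx : ‖x‖ < rho) (hy : ‖y‖ < rho) :
      deriv (fun x' => (Φ (s, (t s, lam s))).eval x' y) x =
        deriv (fun x' => pre Z t s (lam s * x') (lam s * y)) x := by
    refine EventuallyEq.deriv_eq ?_
    filter_upwards [eventually_norm_lt hx] with x' hx'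
    exact hev (x', y) (max_lt hx' hy)
  refine ⟨⟨Φ (s, (t s, lam s)), FunSpace.mem_symSubmodule_of_deriv_eq fun x y hx hy => ?_⟩, hev⟩
  rw [hderiv x y hx hy, hderiv y x hy hx, (hR.hasDerivAt_pre_lam_mul_fst hZ hU hs hx hy).deriv,
    (hR.hasDerivAt_pre_lam_mul_fst hZ hU hs hy hx).deriv,
    hZ.preD₁_symm hU hs (hR.domain s hs x hx.le) (hR.domain s hs y hy.le)]
  ring

theorem ev_renorm (hR : IsScaling U r Z t lam) (hZ : IsMidpointBranch U r Z) (hU : IsOpen U)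
    (hs : s ∈ U) (hx : ‖x‖ < rho) (hy : ‖y‖ < rho) :
    ev (renorm Z t lam s) x y = (mu Z t lam s)⁻¹ * pre Z t s (lam s * x) (lam s * y) := by
  obtain ⟨g, hg⟩ := hR.exists_ev_eq_pre hZ hU hs
  refine ev_ofFun (g := (mu Z t lam s)⁻¹ • g) (fun p hp => ?_) (p := (x, y)) (max_lt hx hy)
  rw [← evL_apply hp, map_smul, evL_apply hp, hg p hp, smul_eq_mul]

theorem preUncurried_eq_zero (hR : IsScaling U r Z t lam) (hs : s ∈ U) :
    preUncurried Z (s, (lam s + t s * lam s ^ 2, 0)) = 0 := by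
  simpa [pre, preUncurried] using hR.zero s hs

theorem differentiableAt_lam (hR : IsScaling U r Z t lam) (hZ : IsMidpointBranch U r Z)
    (hU : IsOpen U) (hs : s ∈ U) (ht : DifferentiableAt ℂ t s) : DifferentiableAt ℂ lam s := by
  let M : (SymSpace × ℂ) × ℂ → ℂ := fun v => preUncurried Z (v.1.1, (v.2 + v.1.2 * v.2 ^ 2, 0))
  have hM : ContDiffAt ℂ 1 M ((s, t s), lam s) :=
    ContDiffAt.comp (g := preUncurried Z)
      (f := fun v : (SymSpace × ℂ) × ℂ => (v.1.1, (v.2 + v.1.2 * v.2 ^ 2, 0))) _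
      ((hZ.contDiffAt_preUncurried hU hs
        (max_lt (hR.norm_add_lt hs) (by simpa using hZ.r_pos))).of_le (by simp)) (by fun_prop)
  have hM_eq_pre : (fun z => M ((s, t s), z)) = fun z => pre Z t s z 0 := by
    funext z
    simp [M, pre, preUncurried]
  have hsimple : deriv (fun z => M ((s, t s), z)) (lam s) ≠ 0 := by
    rw [hM_eq_pre]
    exact right_ne_zero_of_mul (hR.mu_ne_zero s hs)
  obtain ⟨f, hf, hsol⟩ := exists_contDiffAt_implicit one_ne_zero hM hsimple
  have hcont : ContinuousAt (fun s => ((s, t s), lam s)) s :=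
    (continuousAt_id.prodMk ht.continuousAt).prodMk (hR.cont.continuousAt (hU.mem_nhds hs))
  have hdiff : DifferentiableAt ℂ (fun s => f (s, t s)) s :=
    (hf.differentiableAt one_ne_zero).fun_comp' (f := fun s => (s, t s)) s
      (differentiableAt_id.prodMk ht)
  refine hdiff.congr_of_eventuallyEq ?_
  filter_upwards [hcont.eventually hsol, hU.mem_nhds hs] with s' hs' hmem
  exact (hs'.1 ((hR.preUncurried_eq_zero hmem).trans (hR.preUncurried_eq_zero hs).symm)).symm

theorem differentiableAt_mu (hR : IsScaling U r Z t lam) (hZ : IsMidpointBranch U r Z)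
    (hU : IsOpen U) (hs : s ∈ U) (ht : DifferentiableAt ℂ t s) :
    DifferentiableAt ℂ (mu Z t lam) s := by
  have hlam := hR.differentiableAt_lam hZ hU hs ht
  have hD₁ : DifferentiableAt ℂ (fun s => preD₁ Z s (lam s + t s * lam s ^ 2) 0) s :=
    (hZ.differentiableAt_preD₁ hU hs (hR.norm_add_lt hs) (by simpa using hZ.r_pos)).fun_comp'
      (f := fun s => (s, (lam s + t s * lam s ^ 2, 0))) s (by fun_prop)
  have hformula : DifferentiableAt ℂ (fun s => lam s *
      ((1 + 2 * t s * lam s) * preD₁ Z s (lam s + t s * lam s ^ 2) 0)) s := by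
    fun_prop
  refine hformula.congr_of_eventuallyEq ?_
  filter_upwards [hU.mem_nhds hs] with s' hs'
  exact hR.mu_eq hZ hU hs'

theorem differentiableAt_renorm (hR : IsScaling U r Z t lam) (hZ : IsMidpointBranch U r Z)
    (hU : IsOpen U) (hs : s ∈ U) (ht : DifferentiableAt ℂ t s) :
    DifferentiableAt ℂ (renorm Z t lam) s := by
  refine differentiableAt_of_differentiableAt_coe isClosed_symSubmodule ?_
  obtain ⟨Φ, hΦ_diff, hΦ⟩ := hR.exists_differentiableAt_eval_eq_preParam hZ hU hs
  have hparam : DifferentiableAt ℂ (fun s => (s, (t s, lam s))) s :=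
    differentiableAt_id.prodMk (ht.prodMk (hR.differentiableAt_lam hZ hU hs ht))
  have hdiff : DifferentiableAt ℂ (fun s => (mu Z t lam s)⁻¹ • Φ (s, (t s, lam s))) s :=
    ((hR.differentiableAt_mu hZ hU hs ht).inv (hR.mu_ne_zero s hs)).smul
      (hΦ_diff.fun_comp' (f := fun s => (s, (t s, lam s))) s hparam)
  refine hdiff.congr_of_eventuallyEq ?_
  filter_upwards [hparam.continuousAt.eventually hΦ, hU.mem_nhds hs] with s' hΦs' hs'
  refine FunSpace.ext_eval fun p hp => ?_
  rw [← FunSpace.evalL_apply hp (_ • _), map_smul, FunSpace.evalL_apply hp, hΦs' p hp]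
  exact hR.ev_renorm hZ hU hs' ((norm_fst_le p).trans_lt hp) ((norm_snd_le p).trans_lt hp)

end IsScaling

/-! ### The Taylor coefficients of the prerenormalization -/

theorem iteratedDeriv_div_factorial_eq_of_hasSum {𝕜 : Type*} [NontriviallyNormedField 𝕜]
    [CompleteSpace 𝕜] [CharZero 𝕜] {f : 𝕜 → 𝕜} {a : ℕ → 𝕜}
    (hf : ∀ᶠ z in 𝓝 0, HasSum (fun n => a n * z ^ n) (f z)) (n : ℕ) :
    iteratedDeriv n f 0 / (n.factorial : 𝕜) = a n := by
  have hseries : HasFPowerSeriesAt f (.ofScalars 𝕜 a) 0 := by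
    refine hasFPowerSeriesAt_iff.2 (hf.mono fun z hz => ?_)
    simpa only [zero_add, FormalMultilinearSeries.coeff_ofScalars, smul_eq_mul, mul_comm] using hz
  have hcoeff := congrArg (fun P => FormalMultilinearSeries.coeff P n)
    (hseries.analyticAt.hasFPowerSeriesAt.eq_formalMultilinearSeries hseries)
  simpa only [FormalMultilinearSeries.coeff_ofScalars] using hcoeff

namespace FunSpace

theorem hasSum_eval_zero_fst (g : FunSpace) {y : ℂ} (hy : ‖y‖ < rho) :
    HasSum (fun j => g.coeff 0 j * y ^ j) (g.eval 0 y) := by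
  have hsum := (summable_mul_pow_mul_pow g.summable_norm_coeff_mul_pow norm_zero_lt_rho.le
    hy.le).hasSum
  have hsupport : ∀ p ∉ Set.range (Prod.mk (0 : ℕ) : ℕ → ℕ × ℕ),
      g.coeff p.1 p.2 * 0 ^ p.1 * y ^ p.2 = 0 := by
    rintro ⟨_ | i, j⟩ hp
    · exact absurd ⟨j, rfl⟩ hp
    · simp
  refine (((Prod.mk_right_injective (0 : ℕ)).hasSum_iff hsupport).2 hsum).congr_fun fun j => ?_
  simp

theorem iteratedDeriv_div_factorial_eq_coeff_div_pow {g : FunSpace} {f : ℂ → ℂ} {c : ℂ}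
    (hc : c ≠ 0) (h : ∀ y, ‖y‖ < rho → g.eval 0 y = f (c * y)) (j : ℕ) :
    iteratedDeriv j f 0 / (j.factorial : ℂ) = g.coeff 0 j / c ^ j := by
  refine iteratedDeriv_div_factorial_eq_of_hasSum (a := fun j => g.coeff 0 j / c ^ j) ?_ j
  have hcont : ContinuousAt (fun z : ℂ => z / c) 0 := by fun_prop
  filter_upwards [hcont.eventually (eventually_norm_lt (r := rho) (by simpa using rho_pos))]
    with z hz
  have hsum := g.hasSum_eval_zero_fst hz
  rw [h _ hz, mul_div_cancel₀ _ hc] at hsum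
  exact hsum.congr_fun fun n => by rw [div_pow, div_mul_eq_mul_div, mul_div_assoc]

theorem differentiable_coeff (i j : ℕ) : Differentiable ℂ fun g : FunSpace => g.coeff i j := by
  simp only [coeff, div_eq_mul_inv]
  exact (lp.evalCLM ℂ (fun _ : ℕ × ℕ => ℂ) 1 (i, j)).differentiable.mul_const _

end FunSpace

theorem IsScaling.differentiableAt_preCoeff {U : Set SymSpace} {r : ℝ}
    {Z : SymSpace → ℂ × ℂ → ℂ} {lam : SymSpace → ℂ} (hE : IsScaling U r Z (fun _ => 0) lam)
    (hZ : IsMidpointBranch U r Z) (hU : IsOpen U) {s : SymSpace} (hs : s ∈ U) (j : ℕ) :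
    DifferentiableAt ℂ (fun s => preCoeff Z s j) s := by
  obtain ⟨Φ, hΦ_diff, hΦ⟩ := hE.exists_differentiableAt_eval_eq_preParam hZ hU hs
  have hparam : DifferentiableAt ℂ (fun s' : SymSpace => (s', ((0 : ℂ), lam s))) s := by fun_prop
  have hcoeff : DifferentiableAt ℂ (fun s' => (Φ (s', (0, lam s))).coeff 0 j / lam s ^ j) s := by
    simp only [div_eq_mul_inv]
    exact ((FunSpace.differentiable_coeff 0 j).differentiableAt.fun_comp' s
      (hΦ_diff.fun_comp' (f := fun s' => (s', (0, lam s))) s hparam)).mul_const _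
  refine hcoeff.congr_of_eventuallyEq ?_
  filter_upwards [hparam.continuousAt.eventually hΦ] with s' hs'
  refine FunSpace.iteratedDeriv_div_factorial_eq_coeff_div_pow (hE.lam_ne_zero hs)
    (fun y hy => ?_) j
  rw [hs' (0, y) (max_lt norm_zero_lt_rho hy)]
  simp [preParam, preUncurried]

/-! ### The derivative of the renormalization operators at a fixed point -/

section Normalized

variable {s u : SymSpace} {a b c : ℂ}

theorem coeff_dilation_add_coeff_quadratic_eq_zero (hs : ev s 1 0 = 0) (hs' : evD₁ s 1 0 = 1)
    (hu : ∀ x : ℂ, ‖x‖ < rho → ev u x 0 = a * ev s x 0 + (b * x + c * x ^ 2) * evD₁ s x 0)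
    (hu₀ : ev u 1 0 = 0) : b + c = 0 := by
  have hone := hu 1 norm_one_lt_rho
  rw [hu₀, hs, hs'] at hone
  linear_combination -hone

theorem coeff_mul_add_coeff_quadratic_eq_zero (hs : ev s 1 0 = 0) (hs' : evD₁ s 1 0 = 1)
    (hu : ∀ x : ℂ, ‖x‖ < rho → ev u x 0 = a * ev s x 0 + (b * x + c * x ^ 2) * evD₁ s x 0)
    (hu₀ : ev u 1 0 = 0) (hu₁ : evD₁ u 1 0 = 0) : a + c = 0 := by
  have hbc := coeff_dilation_add_coeff_quadratic_eq_zero hs hs' hu hu₀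
  have hderiv_s := (differentiableAt_ev_fst s norm_one_lt_rho norm_zero_lt_rho).hasDerivAt
  have hderiv_D₁ := (differentiableAt_evD₁_fst s norm_one_lt_rho norm_zero_lt_rho).hasDerivAt
  have hderiv_quad : HasDerivAt (fun x : ℂ => b * x + c * x ^ 2) (b + 2 * c) 1 :=
    ((hasDerivAt_const_mul b).add ((hasDerivAt_pow 2 1).const_mul c)).congr_deriv
      (by push_cast; ring)
  have hderiv_u := ((hderiv_s.const_mul a).add (hderiv_quad.mul hderiv_D₁)).deriv
  have heq : (fun x => ev u x 0) =ᶠ[𝓝 1] _ := (eventually_norm_lt norm_one_lt_rho).mono hu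
  have hvalue := heq.deriv_eq.symm.trans hu₁
  rw [show deriv (fun x => a * ev s x 0 + (b * x + c * x ^ 2) * evD₁ s x 0) 1 = _ from hderiv_u,
    show deriv (fun x => ev s x 0) 1 = 1 from hs', hs'] at hvalue
  linear_combination hvalue - (1 + deriv (fun x => evD₁ s x 0) 1) * hbc

/-- The normalization eliminates the infinitesimal multiplication and dilation, two of the three
degrees of freedom of `u`. -/
theorem eq_smul_psiEKW_of_normalized (hψ : psiEKW s ≠ 0) (hs : ev s 1 0 = 0)
    (hs' : evD₁ s 1 0 = 1)
    (hu : ∀ x y : ℂ, ‖x‖ < rho → ‖y‖ < rho → ev u x y = a * ev s x y +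
      b * (x * evD₁ s x y + y * evD₂ s x y) +
        c * (2 * y * ev s x y + x ^ 2 * evD₁ s x y + y ^ 2 * evD₂ s x y))
    (hu₀ : ev u 1 0 = 0) (hu₁ : evD₁ u 1 0 = 0) : u = c • psiEKW s := by
  have hu_axis (x : ℂ) (hx : ‖x‖ < rho) :
      ev u x 0 = a * ev s x 0 + (b * x + c * x ^ 2) * evD₁ s x 0 := by
    rw [hu x 0 hx norm_zero_lt_rho]
    ring
  have hbc := coeff_dilation_add_coeff_quadratic_eq_zero hs hs' hu_axis hu₀
  have hac := coeff_mul_add_coeff_quadratic_eq_zero hs hs' hu_axis hu₀ hu₁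
  refine ext_ev fun p hp => ?_
  have hx := (norm_fst_le p).trans_lt hp
  have hy := (norm_snd_le p).trans_lt hp
  rw [← evL_apply hp (c • psiEKW s), map_smul, evL_apply hp, smul_eq_mul, hu _ _ hx hy,
    ev_psiEKW hψ hx hy]
  linear_combination ev s p.1 p.2 * hac + (p.1 * evD₁ s p.1 p.2 + p.2 * evD₂ s p.1 p.2) * hbc

end Normalized

theorem IsMidpointBranch.hasDerivAt_preParam {U : Set SymSpace} {r : ℝ}
    {Z : SymSpace → ℂ × ℂ → ℂ} (hZ : IsMidpointBranch U r Z) (hU : IsOpen U) {σ : ℂ → SymSpace}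
    {τ Λ : ℂ → ℂ} {v : SymSpace} {τ' Λ' x y a : ℂ} (hσ : HasDerivAt σ v a)
    (hτ : HasDerivAt τ τ' a) (hΛ : HasDerivAt Λ Λ' a) (hσa : σ a ∈ U) (hτa : τ a = 0)
    (hx : ‖Λ a * x‖ < r) (hy : ‖Λ a * y‖ < r) :
    HasDerivAt (fun z => preParam Z ((σ z, (τ z, Λ z)), (x, y)))
      (fderiv ℂ (preUncurried Z) (σ a, (Λ a * x, Λ a * y)) (v, 0) +
        Λ' * (x * preD₁ Z (σ a) (Λ a * x) (Λ a * y) + y * preD₂ Z (σ a) (Λ a * x) (Λ a * y)) +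
        τ' * (2 * (Λ a * y) * preEKW Z (σ a) (Λ a * x) (Λ a * y) +
          (Λ a * x) ^ 2 * preD₁ Z (σ a) (Λ a * x) (Λ a * y) +
          (Λ a * y) ^ 2 * preD₂ Z (σ a) (Λ a * x) (Λ a * y))) a := by
  have hcoord (x : ℂ) : HasDerivAt (fun z => Λ z * x + τ z * (Λ z * x) ^ 2)
      (Λ' * x + τ' * (Λ a * x) ^ 2) a :=
    ((hΛ.mul_const x).add (hτ.mul ((hΛ.mul_const x).pow 2))).congr_deriv (by simp [hτa])
  have hprefactor : HasDerivAt (fun z => 1 + 2 * τ z * (Λ z * y)) (2 * τ' * (Λ a * y)) a :=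
    (((hτ.const_mul 2).mul (hΛ.mul_const y)).const_add 1).congr_deriv (by simp [hτa])
  have hpre : HasDerivAt (fun z => preUncurried Z (σ z,
      (Λ z * x + τ z * (Λ z * x) ^ 2, Λ z * y + τ z * (Λ z * y) ^ 2)))
      (fderiv ℂ (preUncurried Z) (σ a, (Λ a * x, Λ a * y))
        (v, (Λ' * x + τ' * (Λ a * x) ^ 2, Λ' * y + τ' * (Λ a * y) ^ 2))) a :=
    HasFDerivAt.comp_hasDerivAt_of_eq a
      (hZ.differentiableAt_preUncurried hU hσa (max_lt hx hy)).hasFDerivAt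
      (hσ.prodMk ((hcoord x).prodMk (hcoord y))) (by simp [hτa])
  refine (hprefactor.mul hpre).congr_deriv ?_
  rw [hZ.fderiv_preUncurried_eq_add hU hσa hx hy]
  simp only [hτa, preUncurried, zero_mul, mul_zero, add_zero, one_mul]
  ring

namespace IsScaling

variable {U : Set SymSpace} {r : ℝ} {Z : SymSpace → ℂ × ℂ → ℂ} {t lam lamE : SymSpace → ℂ}
  {s : SymSpace} {x y : ℂ}

theorem ev_renorm_one_zero (hR : IsScaling U r Z t lam) (hZ : IsMidpointBranch U r Z)
    (hU : IsOpen U) (hs : s ∈ U) : ev (renorm Z t lam s) 1 0 = 0 := by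
  rw [hR.ev_renorm hZ hU hs norm_one_lt_rho norm_zero_lt_rho, mul_one, mul_zero, hR.zero s hs,
    mul_zero]

theorem evD₁_renorm_one_zero (hR : IsScaling U r Z t lam) (hZ : IsMidpointBranch U r Z)
    (hU : IsOpen U) (hs : s ∈ U) : evD₁ (renorm Z t lam s) 1 0 = 1 := by
  have hev : (fun x => ev (renorm Z t lam s) x 0) =ᶠ[𝓝 1]
      fun x => (mu Z t lam s)⁻¹ * pre Z t s (lam s * x) (lam s * 0) := by
    filter_upwards [eventually_norm_lt norm_one_lt_rho] with x hx
    exact hR.ev_renorm hZ hU hs hx norm_zero_lt_rho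
  have hderiv := hR.hasDerivAt_pre_lam_mul_fst hZ hU hs norm_one_lt_rho norm_zero_lt_rho
  rw [evD₁, hev.deriv_eq, (hderiv.const_mul _).deriv, inv_mul_eq_one₀ (hR.mu_ne_zero s hs),
    hR.mu_eq hZ hU hs]
  ring_nf

theorem ev_fderiv_renorm_one_zero (hR : IsScaling U r Z t lam) (hZ : IsMidpointBranch U r Z)
    (hU : IsOpen U) (hs : s ∈ U) (ht : DifferentiableAt ℂ t s) (v : SymSpace) :
    ev (fderiv ℂ (renorm Z t lam) s v) 1 0 = 0 := by
  have hp : ‖((1, 0) : ℂ × ℂ)‖ < rho := max_lt norm_one_lt_rho norm_zero_lt_rho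
  have hD := (evL (1, 0)).hasFDerivAt.comp s (hR.differentiableAt_renorm hZ hU hs ht).hasFDerivAt
  have hconst := hD.congr_of_eventuallyEq (f₁ := fun _ => (0 : ℂ)) <| by
    filter_upwards [hU.mem_nhds hs] with s' hs'
    exact ((evL_apply hp _).trans (hR.ev_renorm_one_zero hZ hU hs')).symm
  exact (evL_apply hp _).symm.trans
    (DFunLike.congr_fun (hconst.unique (hasFDerivAt_const (0 : ℂ) s)) v)

theorem evD₁_fderiv_renorm_one_zero (hR : IsScaling U r Z t lam) (hZ : IsMidpointBranch U r Z)
    (hU : IsOpen U) (hs : s ∈ U) (ht : DifferentiableAt ℂ t s) (v : SymSpace) :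
    evD₁ (fderiv ℂ (renorm Z t lam) s v) 1 0 = 0 := by
  have hD := (evD₁L 1 0).hasFDerivAt.comp s
    (hR.differentiableAt_renorm hZ hU hs ht).hasFDerivAt
  have happly := evD₁L_apply norm_one_lt_rho norm_zero_lt_rho
  have hconst := hD.congr_of_eventuallyEq (f₁ := fun _ => (1 : ℂ)) <| by
    filter_upwards [hU.mem_nhds hs] with s' hs'
    exact ((happly _).trans (hR.evD₁_renorm_one_zero hZ hU hs')).symm
  exact (happly _).symm.trans
    (DFunLike.congr_fun (hconst.unique (hasFDerivAt_const (1 : ℂ) s)) v)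

theorem norm_lam_mul_lt (hR : IsScaling U r Z t lam) (hs : s ∈ U) (ht0 : t s = 0)
    (hx : ‖x‖ < rho) : ‖lam s * x‖ < r := by
  simpa only [ht0, zero_mul, add_zero] using hR.domain s hs x hx.le

theorem ev_eq_of_renorm_eq_self (hR : IsScaling U r Z t lam) (hZ : IsMidpointBranch U r Z)
    (hU : IsOpen U) (hs : s ∈ U) (ht0 : t s = 0) (hfix : renorm Z t lam s = s) (hx : ‖x‖ < rho)
    (hy : ‖y‖ < rho) : ev s x y = (mu Z t lam s)⁻¹ * preEKW Z s (lam s * x) (lam s * y) := by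
  have hev := hR.ev_renorm hZ hU hs hx hy
  rw [hfix] at hev
  simpa only [pre, ht0, mul_zero, zero_mul, add_zero, one_mul] using hev

theorem evD₁_eq_of_renorm_eq_self (hR : IsScaling U r Z t lam) (hZ : IsMidpointBranch U r Z)
    (hU : IsOpen U) (hs : s ∈ U) (ht0 : t s = 0) (hfix : renorm Z t lam s = s) (hx : ‖x‖ < rho)
    (hy : ‖y‖ < rho) :
    evD₁ s x y = (mu Z t lam s)⁻¹ * (lam s * preD₁ Z s (lam s * x) (lam s * y)) := by
  have hderiv := hZ.hasDerivAt_preEKW hU hs (hasDerivAt_const_mul (lam s))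
    (hasDerivAt_const x (lam s * y)) (hR.norm_lam_mul_lt hs ht0 hx) (hR.norm_lam_mul_lt hs ht0 hy)
  rw [zero_mul, add_zero] at hderiv
  rw [evD₁, ← (hderiv.const_mul _).deriv]
  refine EventuallyEq.deriv_eq ?_
  filter_upwards [eventually_norm_lt hx] with x' hx'
  exact hR.ev_eq_of_renorm_eq_self hZ hU hs ht0 hfix hx' hy

theorem evD₂_eq_of_renorm_eq_self (hR : IsScaling U r Z t lam) (hZ : IsMidpointBranch U r Z)
    (hU : IsOpen U) (hs : s ∈ U) (ht0 : t s = 0) (hfix : renorm Z t lam s = s) (hx : ‖x‖ < rho)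
    (hy : ‖y‖ < rho) :
    evD₂ s x y = (mu Z t lam s)⁻¹ * (lam s * preD₂ Z s (lam s * x) (lam s * y)) := by
  have hderiv := hZ.hasDerivAt_preEKW hU hs (hasDerivAt_const y (lam s * x))
    (hasDerivAt_const_mul (lam s)) (hR.norm_lam_mul_lt hs ht0 hx) (hR.norm_lam_mul_lt hs ht0 hy)
  rw [zero_mul, zero_add] at hderiv
  rw [evD₂, ← (hderiv.const_mul _).deriv]
  refine EventuallyEq.deriv_eq ?_
  filter_upwards [eventually_norm_lt hy] with y' hy'
  exact hR.ev_eq_of_renorm_eq_self hZ hU hs ht0 hfix hx hy'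

theorem ev_fderiv_renorm (hR : IsScaling U r Z t lam) (hZ : IsMidpointBranch U r Z)
    (hU : IsOpen U) (hs : s ∈ U) (ht : DifferentiableAt ℂ t s) (ht0 : t s = 0) (v : SymSpace)
    (hx : ‖x‖ < rho) (hy : ‖y‖ < rho) :
    ev (fderiv ℂ (renorm Z t lam) s v) x y =
      -fderiv ℂ (mu Z t lam) s v / mu Z t lam s ^ 2 * preEKW Z s (lam s * x) (lam s * y) +
      (mu Z t lam s)⁻¹ * (fderiv ℂ (preUncurried Z) (s, (lam s * x, lam s * y)) (v, 0) +
        fderiv ℂ lam s v * (x * preD₁ Z s (lam s * x) (lam s * y) +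
          y * preD₂ Z s (lam s * x) (lam s * y)) +
        fderiv ℂ t s v * (2 * (lam s * y) * preEKW Z s (lam s * x) (lam s * y) +
          (lam s * x) ^ 2 * preD₁ Z s (lam s * x) (lam s * y) +
          (lam s * y) ^ 2 * preD₂ Z s (lam s * x) (lam s * y))) := by
  have hp : ‖(x, y)‖ < rho := max_lt hx hy
  have hline : HasDerivAt (fun z : ℂ => s + z • v) v 0 := by
    simpa using ((hasDerivAt_id (0 : ℂ)).smul_const v).const_add s
  have hline_zero : s + (0 : ℂ) • v = s := by rw [zero_smul, add_zero]
  have hmem : ∀ᶠ z : ℂ in 𝓝 0, s + z • v ∈ U :=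
    hline.continuousAt.preimage_mem_nhds (by rw [hline_zero]; exact hU.mem_nhds hs)
  have hpre := hZ.hasDerivAt_preParam hU (x := x) (y := y) hline
    (ht.hasFDerivAt.hasLineDerivAt v)
    ((hR.differentiableAt_lam hZ hU hs ht).hasFDerivAt.hasLineDerivAt v)
    (by rwa [hline_zero]) (by rwa [hline_zero])
    (by simpa only [hline_zero] using hR.norm_lam_mul_lt hs ht0 hx)
    (by simpa only [hline_zero] using hR.norm_lam_mul_lt hs ht0 hy)
  have hmu := ((hR.differentiableAt_mu hZ hU hs ht).hasFDerivAt.hasLineDerivAt v).inv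
    (by simpa only [hline_zero] using hR.mu_ne_zero s hs)
  have hev := (evL (x, y)).hasFDerivAt.comp_hasDerivAt (0 : ℂ)
    ((hR.differentiableAt_renorm hZ hU hs ht).hasFDerivAt.hasLineDerivAt v)
  have hunique := hev.unique ((hmu.mul hpre).congr_of_eventuallyEq (by
    filter_upwards [hmem] with z hz
    exact (evL_apply hp _).trans (hR.ev_renorm hZ hU hz hx hy)))
  rw [evL_apply hp] at hunique
  simpa [hline_zero, ht0, preParam, preUncurried] using hunique

/-- The coefficients `a` and `b` come from the variations of `μ` and `λ`. -/
theorem exists_ev_fderiv_renorm_of_renorm_eq_self (hR : IsScaling U r Z t lam)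
    (hZ : IsMidpointBranch U r Z) (hU : IsOpen U) (hs : s ∈ U) (ht : DifferentiableAt ℂ t s)
    (ht0 : t s = 0) (hfix : renorm Z t lam s = s) (v : SymSpace) :
    ∃ a b : ℂ, ∀ x y : ℂ, ‖x‖ < rho → ‖y‖ < rho →
      ev (fderiv ℂ (renorm Z t lam) s v) x y =
        (mu Z t lam s)⁻¹ * fderiv ℂ (preUncurried Z) (s, (lam s * x, lam s * y)) (v, 0) +
        a * ev s x y + b * (x * evD₁ s x y + y * evD₂ s x y) +
        lam s * fderiv ℂ t s v *
          (2 * y * ev s x y + x ^ 2 * evD₁ s x y + y ^ 2 * evD₂ s x y) := by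
  refine ⟨-(fderiv ℂ (mu Z t lam) s v / mu Z t lam s), fderiv ℂ lam s v / lam s,
    fun x y hx hy => ?_⟩
  have hlam := hR.lam_ne_zero hs
  have hmu := hR.mu_ne_zero s hs
  rw [hR.ev_fderiv_renorm hZ hU hs ht ht0 v hx hy,
    hR.ev_eq_of_renorm_eq_self hZ hU hs ht0 hfix hx hy,
    hR.evD₁_eq_of_renorm_eq_self hZ hU hs ht0 hfix hx hy,
    hR.evD₂_eq_of_renorm_eq_self hZ hU hs ht0 hfix hx hy]
  field_simp
  ring

theorem fderiv_renormEKW_psiEKW (hE : IsScaling U r Z (fun _ => 0) lamE)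
    (hZ : IsMidpointBranch U r Z) (hU : IsOpen U) (hs : s ∈ U) (hfix : renormEKW Z lamE s = s)
    (hψ : psiEKW s ≠ 0) : fderiv ℂ (renormEKW Z lamE) s (psiEKW s) = lamE s • psiEKW s := by
  have ht : DifferentiableAt ℂ (fun _ : SymSpace => (0 : ℂ)) s := differentiableAt_const _
  have hs_one := hE.ev_renorm_one_zero hZ hU hs
  have hs_one' := hE.evD₁_renorm_one_zero hZ hU hs
  rw [← renormEKW, hfix] at hs_one hs_one'
  obtain ⟨a, b, hab⟩ :=
    hE.exists_ev_fderiv_renorm_of_renorm_eq_self hZ hU hs ht rfl hfix (psiEKW s)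
  refine eq_smul_psiEKW_of_normalized (a := a - 1) (b := b - 1) hψ hs_one hs_one'
    (fun x y hx hy => ?_) (hE.ev_fderiv_renorm_one_zero hZ hU hs ht _)
    (hE.evD₁_fderiv_renorm_one_zero hZ hU hs ht _)
  rw [renormEKW, hab x y hx hy, hZ.fderiv_preUncurried_psiEKW hU hs hψ
    (hE.norm_lam_mul_lt hs rfl hx) (hE.norm_lam_mul_lt hs rfl hy)]
  simp only [fderiv_fun_const, Pi.zero_apply, zero_apply]
  linear_combination
    (1 - 2 * lamE s * y) * hE.ev_eq_of_renorm_eq_self hZ hU hs rfl hfix hx hy +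
    (x - lamE s * x ^ 2) * hE.evD₁_eq_of_renorm_eq_self hZ hU hs rfl hfix hx hy +
    (y - lamE s * y ^ 2) * hE.evD₂_eq_of_renorm_eq_self hZ hU hs rfl hfix hx hy

end IsScaling

section VanishingParameter

variable {Z : SymSpace → ℂ × ℂ → ℂ} {t lam lamE : SymSpace → ℂ} {s : SymSpace}

theorem mu_eq_mu_zero (ht0 : t s = 0) (hlam : lam s = lamE s) :
    mu Z t lam s = mu Z (fun _ => 0) lamE s := by
  simp only [mu, pre, ht0, hlam]

theorem renorm_eq_renormEKW (ht0 : t s = 0) (hlam : lam s = lamE s) :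
    renorm Z t lam s = renormEKW Z lamE s := by
  simp only [renormEKW, renorm, mu_eq_mu_zero ht0 hlam, pre, ht0, hlam]

theorem IsScaling.fderiv_renorm_apply {U : Set SymSpace} {r : ℝ}
    (hE : IsScaling U r Z (fun _ => 0) lamE) (hR : IsScaling U r Z t lam)
    (hZ : IsMidpointBranch U r Z) (hU : IsOpen U) (hs : s ∈ U) (ht : DifferentiableAt ℂ t s)
    (ht0 : t s = 0) (hlam : lam s = lamE s) (hfix : renormEKW Z lamE s = s)
    (hψ : psiEKW s ≠ 0) (v : SymSpace) :
    fderiv ℂ (renorm Z t lam) s v =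
      fderiv ℂ (renormEKW Z lamE) s v + (lamE s * fderiv ℂ t s v) • psiEKW s := by
  have htE : DifferentiableAt ℂ (fun _ : SymSpace => (0 : ℂ)) s := differentiableAt_const _
  have hs_one := hE.ev_renorm_one_zero hZ hU hs
  have hs_one' := hE.evD₁_renorm_one_zero hZ hU hs
  rw [← renormEKW, hfix] at hs_one hs_one'
  obtain ⟨aE, bE, hDE⟩ := hE.exists_ev_fderiv_renorm_of_renorm_eq_self hZ hU hs htE rfl hfix v
  obtain ⟨aR, bR, hDR⟩ := hR.exists_ev_fderiv_renorm_of_renorm_eq_self hZ hU hs ht ht0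
    ((renorm_eq_renormEKW ht0 hlam).trans hfix) v
  rw [← sub_eq_iff_eq_add']
  refine eq_smul_psiEKW_of_normalized (a := aR - aE) (b := bR - bE) hψ hs_one hs_one'
    (fun x y hx hy => ?_) ?_ ?_
  · rw [ev_sub _ _ hx hy, renormEKW, hDE x y hx hy, hDR x y hx hy, mu_eq_mu_zero ht0 hlam, hlam]
    simp only [fderiv_fun_const, Pi.zero_apply, zero_apply]
    ring
  · rw [ev_sub _ _ norm_one_lt_rho norm_zero_lt_rho, hR.ev_fderiv_renorm_one_zero hZ hU hs ht,
      renormEKW, hE.ev_fderiv_renorm_one_zero hZ hU hs htE, sub_zero]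
  · rw [evD₁_sub _ _ norm_one_lt_rho norm_zero_lt_rho,
      hR.evD₁_fderiv_renorm_one_zero hZ hU hs ht, renormEKW,
      hE.evD₁_fderiv_renorm_one_zero hZ hU hs htE, sub_zero]

end VanishingParameter

/-! ### Spectral theory -/

section Spectrum

variable {𝕜 X : Type*} [NontriviallyNormedField 𝕜] [NormedAddCommGroup X] [NormedSpace 𝕜 X]

theorem resolvent_apply_of_eigenvector {L : X →L[𝕜] X} {w : X} {κ z : 𝕜}
    (hz : z ∈ resolventSet 𝕜 L) (hzκ : z ≠ κ) (hw : L w = κ • w) :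
    resolvent L z w = (z - κ)⁻¹ • w := by
  have hsub : (algebraMap 𝕜 (X →L[𝕜] X) z - L) w = (z - κ) • w := by
    rw [sub_smul, ← hw]
    rfl
  have hcancel : resolvent L z ((algebraMap 𝕜 (X →L[𝕜] X) z - L) w) = w :=
    DFunLike.congr_fun (Ring.inverse_mul_cancel _ hz) w
  rwa [hsub, map_smul, ← eq_inv_smul_iff₀ (sub_ne_zero.2 hzκ)] at hcancel

variable {A B : X →L[𝕜] X} {w : X} {a b z : 𝕜}

theorem injective_smul_sub_of_eq_mod_eigenvector (hA : A w = a • w) (hB : B w = b • w)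
    (hAB : ∀ v, ∃ c : 𝕜, A v - B v = c • w) (hza : z ≠ a) (hzb : z ≠ b)
    (hinj : Function.Injective (algebraMap 𝕜 (X →L[𝕜] X) z - B)) :
    Function.Injective (algebraMap 𝕜 (X →L[𝕜] X) z - A) := by
  refine (injective_iff_map_eq_zero _).2 fun v hv => ?_
  replace hv : z • v = A v := sub_eq_zero.1 hv
  obtain ⟨c, hc⟩ := hAB v
  have hv_eq : v = (c / (z - b)) • w := hinj <| by
    change z • v - B v = z • (c / (z - b)) • w - B ((c / (z - b)) • w)
    rw [map_smul B, hB, smul_comm z, ← smul_sub, ← sub_smul, smul_smul,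
      div_mul_cancel₀ _ (sub_ne_zero.2 hzb), ← hc, hv]
  have hv_eigen : A v = a • v := by rw [hv_eq, map_smul, hA, smul_comm]
  rw [hv_eigen, ← sub_eq_zero, ← sub_smul] at hv
  exact (smul_eq_zero.1 hv).resolve_left (sub_ne_zero.2 hza)

theorem surjective_smul_sub_of_eq_mod_eigenvector (hA : A w = a • w)
    (hAB : ∀ v, ∃ c : 𝕜, A v - B v = c • w) (hza : z ≠ a)
    (hsurj : Function.Surjective (algebraMap 𝕜 (X →L[𝕜] X) z - B)) :
    Function.Surjective (algebraMap 𝕜 (X →L[𝕜] X) z - A) := by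
  intro u
  obtain ⟨v, rfl⟩ := hsurj u
  obtain ⟨c, hc⟩ := hAB v
  refine ⟨v + (c / (z - a)) • w, ?_⟩
  change z • (v + _) - A (v + _) = z • v - B v
  have hw : z • (c / (z - a)) • w - A ((c / (z - a)) • w) = A v - B v := by
    rw [map_smul, hA, smul_comm z, ← smul_sub, ← sub_smul, smul_smul,
      div_mul_cancel₀ _ (sub_ne_zero.2 hza), hc]
  rw [smul_add, map_add, add_sub_add_comm, hw]
  abel

theorem mem_spectrum_of_eq_mod_eigenvector [CompleteSpace X] (hw : w ≠ 0) (hA : A w = a • w)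
    (hB : B w = b • w) (hAB : ∀ v, ∃ c : 𝕜, A v - B v = c • w) (hza : z ≠ a)
    (hz : z ∈ spectrum 𝕜 A) : z ∈ spectrum 𝕜 B := by
  contrapose! hz
  replace hz := ContinuousLinearMap.isUnit_iff_bijective.1 (spectrum.notMem_iff.1 hz)
  have hzb : z ≠ b := by
    rintro rfl
    refine hw (hz.1 ?_)
    change z • w - B w = _
    rw [hB, sub_self, map_zero]
  exact spectrum.notMem_iff.2 <| ContinuousLinearMap.isUnit_iff_bijective.2
    ⟨injective_smul_sub_of_eq_mod_eigenvector hA hB hAB hza hzb hz.1,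
      surjective_smul_sub_of_eq_mod_eigenvector hA hAB hza hz.2⟩

end Spectrum

theorem circleIntegral_resolvent_apply_of_eigenvector {X : Type*} [NormedAddCommGroup X]
    [NormedSpace ℂ X] [CompleteSpace X] {L : X →L[ℂ] X} {w : X} {κ : ℂ} {ε : ℝ} (hε : 0 < ε)
    (hsphere : sphere κ ε ⊆ resolventSet ℂ L) (hw : L w = κ • w) :
    (∮ z in C(κ, ε), resolvent L z) w = (2 * (Real.pi : ℂ) * Complex.I) • w := by
  have hcont : ContinuousOn (resolvent L) (sphere κ ε) := fun z hz =>
    (spectrum.hasDerivAt_resolvent_const_left (hsphere hz)).continuousAt.continuousWithinAt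
  have hresolvent (z : ℂ) (hz : z ∈ sphere κ ε) : resolvent L z w = (z - κ)⁻¹ • w :=
    resolvent_apply_of_eigenvector (hsphere hz) (ne_of_mem_sphere hz hε.ne') hw
  calc (∮ z in C(κ, ε), resolvent L z) w = ∮ z in C(κ, ε), resolvent L z w :=
        ContinuousLinearMap.intervalIntegral_apply (hcont.circleIntegrable hε.le).out w
    _ = ∮ z in C(κ, ε), (z - κ)⁻¹ • w := circleIntegral.integral_congr hε.le hresolvent
    _ = (2 * (Real.pi : ℂ) * Complex.I) • w := by
        rw [circleIntegral.integral_smul_const, circleIntegral.integral_sub_center_inv κ hε.ne']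

theorem Isolates.sphere_subset_resolventSet {L : SymSpace →L[ℂ] SymSpace} {κ : ℂ} {ε : ℝ}
    (hε : Isolates L κ ε) : sphere κ ε ⊆ resolventSet ℂ L := by
  intro z hz
  by_contra hspec
  exact ne_of_mem_sphere hz hε.1.ne' (hε.2 z hspec (mem_sphere_iff_norm.1 hz).le)

theorem Isolates.rieszProj_apply_of_eigenvector {L : SymSpace →L[ℂ] SymSpace} {κ : ℂ} {ε : ℝ}
    (hε : Isolates L κ ε) {w : SymSpace} (hw : L w = κ • w) : rieszProj L κ ε w = w := by
  rw [rieszProj, smul_apply,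
    circleIntegral_resolvent_apply_of_eigenvector hε.1 hε.sphere_subset_resolventSet hw,
    inv_smul_smul₀ Complex.two_pi_I_ne_zero]

/-! ### The operators `ℛ` and `ℛ_{c^*}` -/

section Parameters

variable {U : Set SymSpace} {r ε : ℝ} {Z : SymSpace → ℂ × ℂ → ℂ} {lamE lamR : SymSpace → ℂ}
  {sStar : SymSpace} {l : SymSpace →L[ℂ] ℂ}

theorem hasFDerivAt_tRiesz (hd : DifferentiableAt ℂ (renormEKW Z lamE) sStar) :
    HasFDerivAt (tRiesz Z lamE sStar ε l)
      ((-(lamE sStar)⁻¹ •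
        l.comp (rieszProj (fderiv ℂ (renormEKW Z lamE) sStar) (lamE sStar) ε)).comp
          (fderiv ℂ (renormEKW Z lamE) sStar)) sStar :=
  (-(lamE sStar)⁻¹ • l.comp (rieszProj (fderiv ℂ (renormEKW Z lamE) sStar) (lamE sStar) ε)
    ).hasFDerivAt.comp sStar (hd.hasFDerivAt.sub_const sStar)

theorem tRiesz_eq_zero (hfix : renormEKW Z lamE sStar = sStar) :
    tRiesz Z lamE sStar ε l sStar = 0 := by
  rw [tRiesz, hfix, sub_self, map_zero, map_zero, mul_zero]

theorem IsScaling.fderiv_tRiesz_psiEKW (hE : IsScaling U r Z (fun _ => 0) lamE)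
    (hZ : IsMidpointBranch U r Z) (hU : IsOpen U) (hs : sStar ∈ U)
    (hfix : renormEKW Z lamE sStar = sStar)
    (hε : Isolates (fderiv ℂ (renormEKW Z lamE) sStar) (lamE sStar) ε)
    (hl : l (psiEKW sStar) = 1) :
    fderiv ℂ (tRiesz Z lamE sStar ε l) sStar (psiEKW sStar) = -1 := by
  have hψ : psiEKW sStar ≠ 0 := fun h => by simp [h] at hl
  have heigen := hE.fderiv_renormEKW_psiEKW hZ hU hs hfix hψ
  have hd := hE.differentiableAt_renorm hZ hU hs (differentiableAt_const _)
  rw [(hasFDerivAt_tRiesz hd).fderiv, ContinuousLinearMap.comp_apply, heigen, map_smul, smul_apply,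
    ContinuousLinearMap.comp_apply, hε.rieszProj_apply_of_eigenvector heigen, hl, smul_eq_mul,
    smul_eq_mul, mul_one, mul_neg, mul_inv_cancel₀ (hE.lam_ne_zero hs)]

theorem IsScaling.fderiv_renorm_tRiesz_psiEKW (hE : IsScaling U r Z (fun _ => 0) lamE)
    (hR : IsScaling U r Z (tRiesz Z lamE sStar ε l) lamR) (hZ : IsMidpointBranch U r Z)
    (hU : IsOpen U) (hs : sStar ∈ U) (hlam : lamR sStar = lamE sStar)
    (hfix : renormEKW Z lamE sStar = sStar)
    (hε : Isolates (fderiv ℂ (renormEKW Z lamE) sStar) (lamE sStar) ε)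
    (hl : l (psiEKW sStar) = 1) :
    fderiv ℂ (renorm Z (tRiesz Z lamE sStar ε l) lamR) sStar (psiEKW sStar) = 0 := by
  have hψ : psiEKW sStar ≠ 0 := fun h => by simp [h] at hl
  have hd := hE.differentiableAt_renorm hZ hU hs (differentiableAt_const _)
  rw [hE.fderiv_renorm_apply hR hZ hU hs (hasFDerivAt_tRiesz hd).differentiableAt
      (tRiesz_eq_zero hfix) hlam hfix hψ, hE.fderiv_renormEKW_psiEKW hZ hU hs hfix hψ,
    hE.fderiv_tRiesz_psiEKW hZ hU hs hfix hε hl, ← add_smul, mul_neg_one, add_neg_cancel, zero_smul]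

theorem IsScaling.differentiableAt_tCoeff (hE : IsScaling U r Z (fun _ => 0) lamE)
    (hZ : IsMidpointBranch U r Z) (hU : IsOpen U) (hs : sStar ∈ U)
    (hcoeff : preCoeff Z sStar 2 ≠ 0) (c : ℂ) : DifferentiableAt ℂ (tCoeff Z c) sStar := by
  have hquot : DifferentiableAt ℂ (fun s => (c - preCoeff Z s 3) / preCoeff Z s 2) sStar := by
    simp only [div_eq_mul_inv]
    exact ((hE.differentiableAt_preCoeff hZ hU hs 3).const_sub c).mul
      ((hE.differentiableAt_preCoeff hZ hU hs 2).inv hcoeff)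
  exact hquot.const_mul (1 / 4)

theorem tCoeff_eq_zero : tCoeff Z (preCoeff Z sStar 3) sStar = 0 := by
  rw [tCoeff, sub_self, zero_div, mul_zero]

end Parameters

theorem mainTheorem7_general {U : Set SymSpace} {r ε : ℝ} {Z : SymSpace → ℂ × ℂ → ℂ}
    {lamE lamR lamC : SymSpace → ℂ} {sStar : SymSpace} {l : SymSpace →L[ℂ] ℂ} (hU : IsOpen U)
    (hs : sStar ∈ U) (hZ : IsMidpointBranch U r Z) (hE : IsScaling U r Z (fun _ => 0) lamE)
    (hfix : renormEKW Z lamE sStar = sStar)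
    (hε : Isolates (fderiv ℂ (renormEKW Z lamE) sStar) (lamE sStar) ε)
    (hl : l (psiEKW sStar) = 1) (hR : IsScaling U r Z (tRiesz Z lamE sStar ε l) lamR)
    (hRstar : lamR sStar = lamE sStar) (hcoeff : preCoeff Z sStar 2 ≠ 0)
    (hC : IsScaling U r Z (tCoeff Z (preCoeff Z sStar 3)) lamC)
    (hCstar : lamC sStar = lamE sStar) :
    DifferentiableAt ℂ (renormEKW Z lamE) sStar ∧
    DifferentiableAt ℂ (renorm Z (tRiesz Z lamE sStar ε l) lamR) sStar ∧
    DifferentiableAt ℂ (renorm Z (tCoeff Z (preCoeff Z sStar 3)) lamC) sStar ∧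
    spectrum ℂ (fderiv ℂ (renorm Z (tRiesz Z lamE sStar ε l) lamR) sStar) \ {0} ⊆
      spectrum ℂ (fderiv ℂ (renorm Z (tCoeff Z (preCoeff Z sStar 3)) lamC) sStar) := by
  have hψ : psiEKW sStar ≠ 0 := fun h => by simp [h] at hl
  have hdE := hE.differentiableAt_renorm hZ hU hs (differentiableAt_const _)
  have htR := (hasFDerivAt_tRiesz (ε := ε) (l := l) hdE).differentiableAt
  have htC := hE.differentiableAt_tCoeff hZ hU hs hcoeff (preCoeff Z sStar 3)
  refine ⟨hdE, hR.differentiableAt_renorm hZ hU hs htR, hC.differentiableAt_renorm hZ hU hs htC,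
    fun z hz => ?_⟩
  have hDR := hE.fderiv_renorm_apply hR hZ hU hs htR (tRiesz_eq_zero hfix) hRstar hfix hψ
  have hDC := hE.fderiv_renorm_apply hC hZ hU hs htC tCoeff_eq_zero hCstar hfix hψ
  refine mem_spectrum_of_eq_mod_eigenvector hψ (a := 0) (b := lamE sStar +
    lamE sStar * fderiv ℂ (tCoeff Z (preCoeff Z sStar 3)) sStar (psiEKW sStar)) ?_ ?_
    (fun v => ⟨lamE sStar * fderiv ℂ (tRiesz Z lamE sStar ε l) sStar v -
      lamE sStar * fderiv ℂ (tCoeff Z (preCoeff Z sStar 3)) sStar v, ?_⟩) hz.2 hz.1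
  · rw [hE.fderiv_renorm_tRiesz_psiEKW hR hZ hU hs hRstar hfix hε hl, zero_smul]
  · rw [hDC, hE.fderiv_renormEKW_psiEKW hZ hU hs hfix hψ, ← add_smul]
  · rw [hDR, hDC, add_sub_add_left_eq_sub, ← sub_smul]

theorem mainTheorem7
    -- the polynomial `s₀` and the point `s^*` of the ball around it
    (s₀ : SymSpace) (_hs₀ : IsPolynomial s₀)
    (sStar : SymSpace) (_hball : sStar ∈ Metric.ball s₀ varrho0)
    -- the domain of the operators (for instance the ball), and the branch `Z[s]`
    (U : Set SymSpace) (hU : IsOpen U) (hsU : sStar ∈ U)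
    (r : ℝ) (Z : SymSpace → ℂ × ℂ → ℂ) (hZ : IsMidpointBranch U r Z)
    -- `s^*` is a fixed point of `ℛ_EKW`, with scaling `λ_* = lamE sStar`
    (lamE : SymSpace → ℂ) (hE : IsScaling U r Z (fun _ => 0) lamE)
    (hfixE : renormEKW Z lamE sStar = sStar)
    -- the contour and the functional in the definition of `ℛ`
    (ε : ℝ) (hε : Isolates (fderiv ℂ (renormEKW Z lamE) sStar) (lamE sStar) ε)
    (l : SymSpace →L[ℂ] ℂ) (hl : l (psiEKW sStar) = 1)
    -- `s^*` is a fixed point of `ℛ`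
    (lamR : SymSpace → ℂ) (hR : IsScaling U r Z (tRiesz Z lamE sStar ε l) lamR)
    (hRstar : lamR sStar = lamE sStar)
    (hfixR : renorm Z (tRiesz Z lamE sStar ε l) lamR sStar = sStar)
    -- `s^*` is a fixed point of `ℛ_{c^*}`
    (cStar : ℂ) (hc : cStar = preCoeff Z sStar 3)
    (hp : ∀ s ∈ U, preCoeff Z s 2 ≠ 0)
    (lamC : SymSpace → ℂ) (hC : IsScaling U r Z (tCoeff Z cStar) lamC)
    (hCstar : lamC sStar = lamE sStar)
    (hfixC : renorm Z (tCoeff Z cStar) lamC sStar = sStar) :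
    DifferentiableAt ℂ (renormEKW Z lamE) sStar ∧
    DifferentiableAt ℂ (renorm Z (tRiesz Z lamE sStar ε l) lamR) sStar ∧
    DifferentiableAt ℂ (renorm Z (tCoeff Z cStar) lamC) sStar ∧
    spectrum ℂ (fderiv ℂ (renorm Z (tRiesz Z lamE sStar ε l) lamR) sStar)
        \ {z : ℂ | ‖z‖ ≤ deltaBound} ⊆
      spectrum ℂ (fderiv ℂ (renorm Z (tCoeff Z cStar) lamC) sStar)
        \ {z : ℂ | ‖z‖ ≤ deltaBound} := by
  subst hc
  obtain ⟨hdE, hdR, hdC, hspec⟩ :=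
    mainTheorem7_general hU hsU hZ hE hfixE hε hl hR hRstar (hp sStar hsU) hC hCstar
  refine ⟨hdE, hdR, hdC, fun z hz => ⟨hspec ⟨hz.1, ?_⟩, hz.2⟩⟩
  rintro rfl
  exact hz.2 (by norm_num [deltaBound])
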